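/- Let $F$ be a nonarchimedean local field with residue cardinality $q$, a power of the prime $p$, and let $\overline F$ be an algebraic closure of $F$ and $\Gamma_F=\mathrm{Aut}(\overline F/F)$. Let $I\supset P$ be its inertia and wild inertia subgroups. Fix a lift $\sigma\in\Gamma_F$ of the arithmetic Frobenius and a topological generator $\tau$ of $I/P$, and let $\Gamma_{F,\iota}\subseteq\Gamma_F$ be the preimage of the subgroup of $\Gamma_F/P$ generated by $\sigma$ and $\tau$. Let $\widetilde F/F$ be a finite Galois extension inside $\overline F$. Let $\widehat G$ be an affine group scheme over $\mathbb Z[\frac1p]$ with an action of $\mathbb G_m\times\mathrm{Gal}(\widetilde F/F)$ by group automorphisms, put ${}^{C}G=\widehat G\rtimes(\mathbb G_m\times\mathrm{Gal}(\widetilde F/F))$, and let $d$ be the projection from ${}^CG$ to $\mathbb G_m\times\mathrm{Gal}(\widetilde F/F)$. (The main case: $\widehat G$ is the dual group of a reductive group $G$ over $F$ that splits over $\widetilde F$, with its pinned Galois action and with $\mathbb G_m$ acting through the half sum of positive coroots of $\widehat G$, viewed as a cocharacter of its adjoint group; then ${}^CG$ is the C-group of $G$.) Let $\widehat G^I\subseteq\widehat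 G$ be the subgroup scheme of points fixed by $I$. Let $\mathrm{Loc}^{\square}$ be the functor sending a $\mathbb Z[\frac1p]$-algebra $A$ to the set of homomorphisms $\rho\colon\Gamma_{F,\iota}\to{}^CG(A)$ that are trivial on an open subgroup of $P$ and satisfy $d\circ\rho=\chi$, where $\chi(\gamma)=(q^{-n},\gamma|_{\widetilde F})$ if $\gamma$ acts on the residue field of $\overline F$ as the $n$-th power of the arithmetic Frobenius. Let $\mathrm{Loc}_{{}^CG}=[\mathrm{Loc}^{\square}/\widehat G]$ (conjugation action) and $\mathrm{Loc}^{\mathrm{sph}}_{{}^CG}=[\widehat G^Iq^{-1}\sigma/\widehat G^I]$ (conjugation inside ${}^CG$), as fppf quotient stacks. Let $\Phi\colon\mathrm{Loc}^{\mathrm{sph}}_{{}^CG}\to\mathrm{Loc}_{{}^CG}$ be the morphism induced by the $\widehat G^I$-equivariant map $\widehat G^Iq^{-1}\sigma\to\mathrm{Loc}^{\square}$ that sends $x$ to the parameter $\rho_x$ with $\rho_x(\gamma)=(1,(1,\gamma|_{\widetilde F}))$ for $\gamma\in I\cap\Gamma_{F,\iota}$ and $\rho_x(\sigma)=x$; it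 sends a $\widehat G^I$-torsor $P$ with an equivariant map to $\widehat G^Iq^{-1}\sigma$ to the induced torsor $P\times^{\widehat G^I}\widehat G$ with the induced equivariant map to $\mathrm{Loc}^{\square}$. For a representation $V$ of $\widehat G$ on a finite locally free $\mathbb Z[\frac1p]$-module, let $\widetilde V$ be the pullback to $\mathrm{Loc}_{{}^CG}$ of the module on $*/\widehat G$ associated with $V$, and let $\widetilde{V|_{\widehat G^I}}$ be the pullback to $\mathrm{Loc}^{\mathrm{sph}}_{{}^CG}$ of the module on $*/\widehat G^I$ associated with $V|_{\widehat G^I}$. Then $\widetilde V$ and $\widetilde{V|_{\widehat G^I}}$ are vector bundles, and there is a canonical isomorphism $$\widetilde{V|_{\widehat G^I}}\;\cong\;\Phi^*\widetilde V$$ of vector bundles on $\mathrm{Loc}^{\mathrm{sph}}_{{}^CG}$: there is exactly one isomorphism, natural in $V$, that on an object with underlying torsor $P$ is given by $P\times^{\widehat G^I}V\to(P\times^{\widehat G^I}\widehat G)\times^{\widehat G}V$, $[p,v]\mapsto[[p,1],v]$. -/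

import Mathlib

open CategoryTheory TensorProduct ValuativeRel

universe u w w'

noncomputable section

namespace LanglandsParameters

set_option linter.unusedSectionVars false
set_option linter.checkUnivs false

section Stacks

variable {k : Type} [CommRing k]

/-- An fppf covering of affine `k`-schemes. -/
def IsFppf {A B : CommAlgCat.{u} k} (f : A ⟶ B) : Prop :=
  f.hom.toRingHom.FaithfullyFlat ∧ f.hom.toRingHom.FinitePresentation

/-- A presheaf of sets on affine `k`-schemes, written covariantly in the `k`-algebra. -/
structure Psh (k : Type) [CommRing k] where
  obj : CommAlgCat.{u} k → Type w
  map : ∀ {A B : CommAlgCat.{u} k}, (A ⟶ B) → obj A → obj B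
  map_id : ∀ {A : CommAlgCat.{u} k} (x : obj A), map (𝟙 A) x = x
  map_comp : ∀ {A B C : CommAlgCat.{u} k} (f : A ⟶ B) (g : B ⟶ C) (x : obj A),
    map (f ≫ g) x = map g (map f x)

/-- The gluing condition for a presheaf with respect to all fppf coverings `Spec B → Spec A`. -/
def Psh.IsSheaf (X : Psh.{u, w} k) : Prop :=
  ∀ {A B : CommAlgCat.{u} k} (f : A ⟶ B), IsFppf f → ∀ x : X.obj B,
    (∀ {C : CommAlgCat.{u} k} (u v : B ⟶ C), f ≫ u = f ≫ v → X.map u x = X.map v x) →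
    ∃! y : X.obj A, X.map f y = x

/-- The presheaf of sets underlying a presheaf of groups. -/
@[simps]
def grpPsh (G : CommAlgCat.{u} k ⥤ GrpCat.{u}) : Psh.{u, u} k where
  obj A := G.obj A
  map f := G.map f
  map_id := by simp
  map_comp := by simp

theorem isFppf_pushout {A B C : CommAlgCat.{u} k} {f : A ⟶ B} (hf : IsFppf f) (g : A ⟶ C) :
    ∃ (D : CommAlgCat.{u} k) (b : B ⟶ D) (c : C ⟶ D), f ≫ b = g ≫ c ∧ IsFppf c := by
  let _ := f.hom.toRingHom.toAlgebra
  let _ := g.hom.toRingHom.toAlgebra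
  have : IsScalarTower k A B := .of_algebraMap_eq fun x => (f.hom.commutes x).symm
  have : IsScalarTower k A C := .of_algebraMap_eq fun x => (g.hom.commutes x).symm
  have h1 : Module.FaithfullyFlat A B := hf.1
  have h2 : Algebra.FinitePresentation A B := hf.2
  refine ⟨CommAlgCat.of k (C ⊗[A] B),
    CommAlgCat.ofHom ((Algebra.TensorProduct.includeRight : B →ₐ[A] C ⊗[A] B).restrictScalars k),
    CommAlgCat.ofHom ((Algebra.TensorProduct.includeLeft : C →ₐ[A] C ⊗[A] B).restrictScalars k),
    ?_, ?_⟩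
  · ext x
    have h3 := (Algebra.TensorProduct.includeRight : B →ₐ[A] C ⊗[A] B).commutes x
    have h4 := (Algebra.TensorProduct.includeLeft : C →ₐ[A] C ⊗[A] B).commutes x
    exact h3.trans h4.symm
  · constructor
    · have : (algebraMap C (C ⊗[A] B)).FaithfullyFlat :=
        (RingHom.faithfullyFlat_algebraMap_iff).mpr inferInstance
      exact this
    · have : (algebraMap C (C ⊗[A] B)).FinitePresentation :=
        (RingHom.finitePresentation_algebraMap).mpr inferInstance
      exact this

/-- Descent of a value that is determined on a sieve containing an fppf covering. -/
theorem Psh.IsSheaf.descend {X : Psh.{u, w} k} (hX : X.IsSheaf) {B : CommAlgCat.{u} k}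
    (R : ∀ {C : CommAlgCat.{u} k}, (B ⟶ C) → X.obj C → Prop)
    (hmap : ∀ {C D : CommAlgCat.{u} k} (f : B ⟶ C) (g : C ⟶ D) (x : X.obj C),
      R f x → R (f ≫ g) (X.map g x))
    (huniq : ∀ {C : CommAlgCat.{u} k} (f : B ⟶ C) (x y : X.obj C), R f x → R f y → x = y)
    (hex : ∃ (C : CommAlgCat.{u} k) (f : B ⟶ C) (x : X.obj C), IsFppf f ∧ R f x) :
    ∃! y : X.obj B, ∀ {C : CommAlgCat.{u} k} (f : B ⟶ C) (x : X.obj C), R f x → X.map f y = x := by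
  obtain ⟨C, f, x, hf, hx⟩ := hex
  obtain ⟨y, hy, hy'⟩ := hX f hf x fun u v huv =>
    huniq (f ≫ u) _ _ (hmap f u x hx) (by rw [huv]; exact hmap f v x hx)
  refine ⟨y, fun {D} g z hz => ?_, fun y' h => hy' y' (h f x hx)⟩
  obtain ⟨E, b, c, hbc, hc⟩ := isFppf_pushout hf g
  have h1 : X.map c z = X.map c (X.map g y) := by
    rw [← X.map_comp, ← hbc, X.map_comp, hy]
    exact huniq (g ≫ c) _ _ (hmap g c z hz) (by rw [← hbc]; exact hmap f b x hx)
  exact (hX c hc (X.map c z) fun u v huv => by rw [← X.map_comp, ← X.map_comp, huv]).unique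
    h1.symm rfl

/-- `Psh.IsSheaf.descend` for a sheaf of groups. -/
theorem grp_descend {G : CommAlgCat.{u} k ⥤ GrpCat.{u}} (hG : (grpPsh G).IsSheaf)
    {B : CommAlgCat.{u} k} (R : ∀ {C : CommAlgCat.{u} k}, (B ⟶ C) → G.obj C → Prop)
    (hmap : ∀ {C D : CommAlgCat.{u} k} (f : B ⟶ C) (g : C ⟶ D) (x : G.obj C),
      R f x → R (f ≫ g) (G.map g x))
    (huniq : ∀ {C : CommAlgCat.{u} k} (f : B ⟶ C) (x y : G.obj C), R f x → R f y → x = y)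
    (hex : ∃ (C : CommAlgCat.{u} k) (f : B ⟶ C) (x : G.obj C), IsFppf f ∧ R f x) :
    ∃! y : G.obj B, ∀ {C : CommAlgCat.{u} k} (f : B ⟶ C) (x : G.obj C), R f x → G.map f y = x :=
  hG.descend R hmap huniq hex

/-- The coordinate-ring description of an affine group scheme gives an fppf sheaf. -/
theorem isSheaf_of_isCorepresentable (G : CommAlgCat.{u} k ⥤ GrpCat.{u})
    [h : (G ⋙ forget GrpCat).IsCorepresentable] : (grpPsh G).IsSheaf := by
  obtain ⟨O, ⟨e⟩⟩ := h
  intro A B f hf x hx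
  let _ := f.hom.toRingHom.toAlgebra
  have : IsScalarTower k A B := .of_algebraMap_eq fun x => (f.hom.commutes x).symm
  have h1 : Module.FaithfullyFlat A B := hf.1
  have hinj : Function.Injective f.hom := RingHom.FaithfullyFlat.injective hf.1
  have hmap : ∀ {C D : CommAlgCat.{u} k} (g : C ⟶ D) (φ : O ⟶ C),
      G.map g (e.homEquiv φ) = e.homEquiv (φ ≫ g) := fun g φ => (e.homEquiv_comp g φ).symm
  obtain ⟨φ, rfl⟩ := e.homEquiv.surjective x
  have hφ : ∀ o, ∃ a, f.hom a = φ.hom o := by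
    intro o
    have h2 := (Algebra.IsEffective.of_faithfullyFlat A B) (φ.hom o)
    refine h2.mp ?_
    rw [Algebra.TensorProduct.includeLeftSubRight_apply, sub_eq_zero]
    let l : B ⟶ CommAlgCat.of k (B ⊗[A] B) := CommAlgCat.ofHom
      ((Algebra.TensorProduct.includeLeft : B →ₐ[A] B ⊗[A] B).restrictScalars k)
    let r : B ⟶ CommAlgCat.of k (B ⊗[A] B) := CommAlgCat.ofHom
      ((Algebra.TensorProduct.includeRight : B →ₐ[A] B ⊗[A] B).restrictScalars k)
    have h3 : f ≫ l = f ≫ r := by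
      ext a
      have h3 := (Algebra.TensorProduct.includeRight : B →ₐ[A] B ⊗[A] B).commutes a
      have h4 := (Algebra.TensorProduct.includeLeft : B →ₐ[A] B ⊗[A] B).commutes a
      exact h4.trans h3.symm
    have h4 := hx l r h3
    simp only [grpPsh_map] at h4
    rw [hmap, hmap] at h4
    have h5 := e.homEquiv.injective h4
    exact congrArg (fun m => m.hom o) h5
  choose ψ hψ using hφ
  let ψ' : O →ₐ[k] A :=
    { toFun := ψ
      map_one' := hinj (by simp [hψ])
      map_mul' := fun a b => hinj (by simp [hψ])
      map_zero' := hinj (by simp [hψ])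
      map_add' := fun a b => hinj (by simp [hψ])
      commutes' := fun a => hinj (by simp [hψ]) }
  have hcomp : ∀ ψ : O ⟶ A, (∀ o, f.hom (ψ.hom o) = φ.hom o) ↔ ψ ≫ f = φ := by
    intro ψ
    constructor
    · intro h; ext o; exact h o
    · rintro rfl o; rfl
  refine ⟨e.homEquiv (CommAlgCat.ofHom ψ'), ?_, ?_⟩
  · simp only [grpPsh_map]
    rw [hmap]
    exact congrArg _ ((hcomp _).mp hψ)
  · intro y hy
    obtain ⟨χ, rfl⟩ := e.homEquiv.surjective y
    simp only [grpPsh_map] at hy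
    rw [hmap] at hy
    have h6 := (hcomp χ).mpr (e.homEquiv.injective hy)
    congr 1
    ext o
    exact hinj ((h6 o).trans (hψ o).symm)

/-- A presheaf of sets with a left action of the presheaf of groups `G`. -/
structure GSpace (G : CommAlgCat.{u} k ⥤ GrpCat.{u}) extends Psh.{u, w} k where
  smul : ∀ {A : CommAlgCat.{u} k}, G.obj A → obj A → obj A
  one_smul : ∀ {A : CommAlgCat.{u} k} (x : obj A), smul 1 x = x
  mul_smul : ∀ {A : CommAlgCat.{u} k} (g h : G.obj A) (x : obj A),
    smul (g * h) x = smul g (smul h x)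
  map_smul : ∀ {A B : CommAlgCat.{u} k} (f : A ⟶ B) (g : G.obj A) (x : obj A),
    map f (smul g x) = smul (G.map f g) (map f x)

/-- The point with the trivial action. -/
def GSpace.point (G : CommAlgCat.{u} k ⥤ GrpCat.{u}) : GSpace.{u, w} G where
  obj _ := PUnit
  map _ x := x
  map_id _ := rfl
  map_comp _ _ _ := rfl
  smul _ x := x
  one_smul _ := rfl
  mul_smul _ _ _ := rfl
  map_smul _ _ _ := rfl

/-- A right fppf `G`-torsor over `Spec A`: a sheaf on affine `A`-schemes with a simply transitive
action of `G` that has sections fppf locally. `pt b` is the set of points over `b : A ⟶ B`. (The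
gluing condition for finite disjoint unions follows from the other conditions when `G` is affine.) -/
structure Torsor (G : CommAlgCat.{u} k ⥤ GrpCat.{u}) (A : CommAlgCat.{u} k) where
  pt : ∀ {B : CommAlgCat.{u} k}, (A ⟶ B) → Type (u + 1)
  map : ∀ {B C : CommAlgCat.{u} k} {b : A ⟶ B} {c : A ⟶ C} (f : B ⟶ C), b ≫ f = c → pt b → pt c
  map_id : ∀ {B : CommAlgCat.{u} k} {b : A ⟶ B} (h : b ≫ 𝟙 B = b) (p : pt b), map (𝟙 B) h p = p
  map_comp : ∀ {B C D : CommAlgCat.{u} k} {b : A ⟶ B} {c : A ⟶ C} {d : A ⟶ D}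
    (f : B ⟶ C) (g : C ⟶ D) (hf : b ≫ f = c) (hg : c ≫ g = d) (h : b ≫ f ≫ g = d) (p : pt b),
    map (f ≫ g) h p = map g hg (map f hf p)
  act : ∀ {B : CommAlgCat.{u} k} {b : A ⟶ B}, pt b → G.obj B → pt b
  act_one : ∀ {B : CommAlgCat.{u} k} {b : A ⟶ B} (p : pt b), act p 1 = p
  act_mul : ∀ {B : CommAlgCat.{u} k} {b : A ⟶ B} (p : pt b) (g h : G.obj B),
    act p (g * h) = act (act p g) h
  map_act : ∀ {B C : CommAlgCat.{u} k} {b : A ⟶ B} {c : A ⟶ C} (f : B ⟶ C) (hf : b ≫ f = c)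
    (p : pt b) (g : G.obj B), map f hf (act p g) = act (map f hf p) (G.map f g)
  transitive : ∀ {B : CommAlgCat.{u} k} {b : A ⟶ B} (p p' : pt b), ∃! g : G.obj B, act p g = p'
  locally_nonempty : ∀ {B : CommAlgCat.{u} k} (b : A ⟶ B),
    ∃ (C : CommAlgCat.{u} k) (f : B ⟶ C), IsFppf f ∧ Nonempty (pt (b ≫ f))
  glue : ∀ {B C : CommAlgCat.{u} k} {b : A ⟶ B} {c : A ⟶ C} (f : B ⟶ C) (hf : b ≫ f = c),
    IsFppf f → ∀ p : pt c,
    (∀ {D : CommAlgCat.{u} k} {d : A ⟶ D} (u v : C ⟶ D) (hu : c ≫ u = d) (hv : c ≫ v = d),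
      f ≫ u = f ≫ v → map u hu p = map v hv p) →
    ∃! p' : pt b, map f hf p' = p

/-- An isomorphism of torsors from `P'` over `Spec A'` to the base change along `f : A ⟶ A'` of
`P` over `Spec A`. -/
structure Torsor.IsoOver {G : CommAlgCat.{u} k ⥤ GrpCat.{u}} {A A' : CommAlgCat.{u} k}
    (f : A ⟶ A') (P' : Torsor G A') (P : Torsor G A) where
  equiv : ∀ {B : CommAlgCat.{u} k} {b' : A' ⟶ B} {b : A ⟶ B}, f ≫ b' = b → P'.pt b' ≃ P.pt b
  natural : ∀ {B C : CommAlgCat.{u} k} {b' : A' ⟶ B} {b : A ⟶ B} {c' : A' ⟶ C} {c : A ⟶ C}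
    (hb : f ≫ b' = b) (hc : f ≫ c' = c) (g : B ⟶ C) (hg' : b' ≫ g = c') (hg : b ≫ g = c)
    (p : P'.pt b'), equiv hc (P'.map g hg' p) = P.map g hg (equiv hb p)
  equivariant : ∀ {B : CommAlgCat.{u} k} {b' : A' ⟶ B} {b : A ⟶ B} (hb : f ≫ b' = b)
    (p : P'.pt b') (g : G.obj B), equiv hb (P'.act p g) = P.act (equiv hb p) g

/-- An object of the quotient stack `[X/G]` over `Spec A`: a `G`-torsor `P` over `Spec A` with an
equivariant map `P ⟶ X`. -/
structure QuotStack {G : CommAlgCat.{u} k ⥤ GrpCat.{u}} (X : GSpace.{u, w} G) where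
  ring : CommAlgCat.{u} k
  torsor : Torsor G ring
  toSpace : ∀ {B : CommAlgCat.{u} k} {b : ring ⟶ B}, torsor.pt b → X.obj B
  natural : ∀ {B C : CommAlgCat.{u} k} {b : ring ⟶ B} {c : ring ⟶ C} (f : B ⟶ C)
    (hf : b ≫ f = c) (p : torsor.pt b), toSpace (torsor.map f hf p) = X.map f (toSpace p)
  equivariant : ∀ {B : CommAlgCat.{u} k} {b : ring ⟶ B} (p : torsor.pt b) (g : G.obj B),
    toSpace (torsor.act p g) = X.smul g⁻¹ (toSpace p)

namespace QuotStack

variable {G H : CommAlgCat.{u} k ⥤ GrpCat.{u}}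

/-- A morphism `x ⟶ y` of the fibred category `[X/G]`, lying over `Spec x.ring ⟶ Spec y.ring`. -/
structure Hom {X : GSpace.{u, w} G} (x y : QuotStack X) where
  base : y.ring ⟶ x.ring
  iso : Torsor.IsoOver base x.torsor y.torsor
  toSpace : ∀ {B : CommAlgCat.{u} k} {b' : x.ring ⟶ B} {b : y.ring ⟶ B} (hb : base ≫ b' = b)
    (p : x.torsor.pt b'), y.toSpace (iso.equiv hb p) = x.toSpace p

theorem Hom.ext' {X : GSpace.{u, w} G} {x y : QuotStack X} {α β : Hom x y}
    (hbase : α.base = β.base)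
    (h : ∀ {B : CommAlgCat.{u} k} {b' : x.ring ⟶ B} {b : y.ring ⟶ B} (hα : α.base ≫ b' = b)
      (hβ : β.base ≫ b' = b) (p : x.torsor.pt b'), α.iso.equiv hα p = β.iso.equiv hβ p) :
    α = β := by
  obtain ⟨f, ⟨e, he, he'⟩, hs⟩ := α
  obtain ⟨f', ⟨e', he2, he2'⟩, hs'⟩ := β
  obtain rfl : f = f' := hbase
  have : @e = @e' := by
    funext B b' b hb
    exact Equiv.ext (h hb hb)
  subst this
  rfl

/-- The identity morphism. -/
@[simps]
def Hom.id {X : GSpace.{u, w} G} (x : QuotStack X) : Hom x x where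
  base := 𝟙 _
  iso :=
    { equiv := fun {B b' b} hb =>
        { toFun := x.torsor.map (𝟙 B) (by rw [← hb, Category.id_comp, Category.comp_id])
          invFun := x.torsor.map (𝟙 B) (by rw [← hb, Category.id_comp, Category.comp_id])
          left_inv := fun p => by
            rw [Category.id_comp] at hb
            subst hb
            simp only [x.torsor.map_id]
          right_inv := fun p => by
            rw [Category.id_comp] at hb
            subst hb
            simp only [x.torsor.map_id] }
      natural := by
        intro B C b' b c' c hb hc g hg' hg p
        rw [Category.id_comp] at hb hc
        subst hb hc
        simp only [Equiv.coe_fn_mk, x.torsor.map_id]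
      equivariant := by
        intro B b' b hb p g
        rw [Category.id_comp] at hb
        subst hb
        simp only [Equiv.coe_fn_mk, x.torsor.map_id] }
  toSpace := by
    intro B b' b hb p
    rw [Category.id_comp] at hb
    subst hb
    simp only [Equiv.coe_fn_mk, x.torsor.map_id]

/-- The composition of morphisms. -/
@[simps]
def Hom.comp {X : GSpace.{u, w} G} {x y z : QuotStack X} (α : Hom x y) (β : Hom y z) :
    Hom x z where
  base := β.base ≫ α.base
  iso :=
    { equiv := fun {B b' b} hb =>
        (α.iso.equiv (b := α.base ≫ b') rfl).trans
          (β.iso.equiv (by rw [← hb, Category.assoc]))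
      natural := by
        intro B C b' b c' c hb hc g hg' hg p
        have h1 := α.iso.natural rfl rfl g hg' (by rw [Category.assoc, hg']) p
        simp only [Equiv.trans_apply, h1]
        exact β.iso.natural _ _ g _ hg _
      equivariant := by
        intro B b' b hb p g
        simp only [Equiv.trans_apply, α.iso.equivariant, β.iso.equivariant] }
  toSpace := by
    intro B b' b hb p
    simp only [Equiv.trans_apply, α.toSpace, β.toSpace]

instance {X : GSpace.{u, w} G} : Category (QuotStack X) where
  Hom := Hom
  id := Hom.id
  comp := Hom.comp
  id_comp {x y} α := by
    refine Hom.ext' (Category.comp_id _) ?_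
    intro B b' b hα hβ p
    have : ∀ (c : x.ring ⟶ B) (h : b' = c) (h' : α.base ≫ c = b) (e : b' ≫ 𝟙 B = c),
        α.iso.equiv h' (x.torsor.map (𝟙 B) e p) = α.iso.equiv hβ p := by
      intro c h h' e
      subst h
      rw [x.torsor.map_id]
    exact this (𝟙 _ ≫ b') (Category.id_comp _).symm _ _
  comp_id {x y} α := by
    refine Hom.ext' (Category.id_comp _) ?_
    intro B b' b hα hβ p
    subst hβ
    exact y.torsor.map_id _ _
  assoc {x y z t} α β γ := by
    refine Hom.ext' (Category.assoc _ _ _).symm ?_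
    intro B b' b hα hβ p
    have : ∀ {c d : z.ring ⟶ B} (q : y.torsor.pt (α.base ≫ b')) (h1 : β.base ≫ α.base ≫ b' = c)
        (h2 : β.base ≫ α.base ≫ b' = d) (h3 : γ.base ≫ c = b) (h4 : γ.base ≫ d = b),
        γ.iso.equiv h3 (β.iso.equiv h1 q) = γ.iso.equiv h4 (β.iso.equiv h2 q) := by
      intro c d q h1 h2 h3 h4
      subst h1 h2
      rfl
    exact this (c := (β.base ≫ α.base) ≫ b') (d := β.base ≫ α.base ≫ b') _
      (Category.assoc _ _ _).symm rfl (by rw [← hα]; exact (Category.assoc _ _ _).symm)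
      (by rw [← hα]; simp)

/-- The structure sheaf of `[X/G]`, sending an object over `Spec A` to `A`. -/
@[simps]
def structureSheaf {G : CommAlgCat.{u} k ⥤ GrpCat.{u}} (X : GSpace.{u, w} G) :
    (QuotStack X)ᵒᵖ ⥤ CommRingCat.{u} where
  obj x := CommRingCat.of x.unop.ring
  map α := CommRingCat.ofHom α.unop.base.hom.toRingHom
  map_id _ := rfl
  map_comp _ _ := rfl

/-- The category of presheaves of modules over the structure sheaf of `[X/G]`. It contains the
vector bundles (see `IsVectorBundle`) as a full subcategory. -/
abbrev Mod {G : CommAlgCat.{u} k ⥤ GrpCat.{u}} (X : GSpace.{u, w} G) : Type _ :=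
  PresheafOfModules.{u + 1} (structureSheaf X ⋙ forget₂ CommRingCat RingCat)

/-- The morphism of stacks `[X/G] ⟶ */G`. -/
def toBG (X : GSpace.{u, w} G) : QuotStack X ⥤ QuotStack (GSpace.point.{u, w} G) where
  obj x :=
    { ring := x.ring
      torsor := x.torsor
      toSpace := fun _ => PUnit.unit
      natural := fun _ _ _ => rfl
      equivariant := fun _ _ => rfl }
  map α :=
    { base := α.base
      iso := α.iso
      toSpace := fun _ _ => rfl }
  map_id _ := rfl
  map_comp _ _ := rfl

/-- Pullback of modules along `[X/G] ⟶ */G`: the module of sections over an object of `[X/G]` is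
the one over its image in `*/G`, which lies over the same ring. -/
def pullbackBG (X : GSpace.{u, w} G) : Mod (GSpace.point.{u, w} G) ⥤ Mod X :=
  PresheafOfModules.pushforward₀OfCommRingCat (toBG X) (structureSheaf (GSpace.point.{u, w} G))

end QuotStack

/-- The base change map `A ⊗ V ⟶ B ⊗ V` along `f : A ⟶ B`. -/
def bc (V : Type u) [AddCommGroup V] [Module k V] {A B : CommAlgCat.{u} k} (f : A ⟶ B) :
    A ⊗[k] V →ₗ[k] B ⊗[k] V :=
  LinearMap.rTensor V f.hom.toLinearMap

theorem bc_smul (V : Type u) [AddCommGroup V] [Module k V] {A B : CommAlgCat.{u} k} (f : A ⟶ B)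
    (a : A) (x : A ⊗[k] V) : bc V f (a • x) = f.hom a • bc V f x := by
  induction x with
  | zero => simp
  | tmul b v => simp [bc, smul_tmul']
  | add x y hx hy => simp [smul_add, hx, hy]

/-- A representation of `G` on a finite locally free `k`-module. -/
structure FinRep (G : CommAlgCat.{u} k ⥤ GrpCat.{u}) where
  V : Type u
  [addCommGroup : AddCommGroup V]
  [module : Module k V]
  [finite : Module.Finite k V]
  [projective : Module.Projective k V]
  ρ : ∀ A : CommAlgCat.{u} k, G.obj A →* Module.End A (A ⊗[k] V)
  natural : ∀ {A B : CommAlgCat.{u} k} (f : A ⟶ B) (g : G.obj A) (x : A ⊗[k] V),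
    bc V f (ρ A g x) = ρ B (G.map f g) (bc V f x)

namespace FinRep

attribute [instance] addCommGroup module finite projective

variable {G H : CommAlgCat.{u} k ⥤ GrpCat.{u}}

/-- A morphism of representations: a `k`-linear map that is equivariant after every base change. -/
@[ext]
structure Hom (V W : FinRep G) where
  lin : V.V →ₗ[k] W.V
  equivariant : ∀ (A : CommAlgCat.{u} k) (g : G.obj A) (x : A ⊗[k] V.V),
    lin.baseChange A (V.ρ A g x) = W.ρ A g (lin.baseChange A x)

instance : Category (FinRep G) where
  Hom := Hom
  id V := ⟨LinearMap.id, fun A g x => by simp⟩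
  comp f g := ⟨g.lin ∘ₗ f.lin, fun A a x => by
    simp only [LinearMap.baseChange_comp, LinearMap.comp_apply, f.equivariant, g.equivariant]⟩

/-- Restriction of representations along a homomorphism `H ⟶ G`. -/
def res (i : H ⟶ G) : FinRep G ⥤ FinRep H where
  obj V :=
    { V := V.V
      ρ := fun A => (V.ρ A).comp (i.app A).hom
      natural := fun {A B} f h x => by
        have h1 : G.map f ((i.app A).hom h) = (i.app B).hom (H.map f h) :=
          (NatTrans.naturality_apply i f h).symm
        have h2 := V.natural f ((i.app A).hom h) x
        rw [h1] at h2
        exact h2 }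
  map f := ⟨f.lin, fun A h x => f.equivariant A _ x⟩
  map_id _ := rfl
  map_comp _ _ := rfl

variable {A : CommAlgCat.{u} k}

/-- The sections over `Spec A` of the vector bundle `P ×^G V` associated with a `G`-torsor `P` over
`Spec A`: the equivariant maps `s : P ⟶ V`, where `s` stands for the section `[p, s(p)]`. -/
def sectionsAddSubgroup (V : FinRep G) (P : Torsor G A) :
    AddSubgroup (∀ {B : CommAlgCat.{u} k} {b : A ⟶ B}, P.pt b → B ⊗[k] V.V) where
  carrier := {s |
    (∀ {B C : CommAlgCat.{u} k} {b : A ⟶ B} {c : A ⟶ C} (f : B ⟶ C) (hf : b ≫ f = c) (p : P.pt b),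
      s (P.map f hf p) = bc V.V f (s p)) ∧
    ∀ {B : CommAlgCat.{u} k} {b : A ⟶ B} (p : P.pt b) (g : G.obj B),
      s (P.act p g) = V.ρ B g⁻¹ (s p)}
  zero_mem' := ⟨fun f hf p => by simp, fun p g => by simp⟩
  add_mem' hs ht :=
    ⟨fun f hf p => by simp [hs.1 f hf, ht.1 f hf], fun p g => by simp [hs.2, ht.2]⟩
  neg_mem' hs := ⟨fun f hf p => by simp [hs.1 f hf], fun p g => by simp [hs.2]⟩

/-- The type of sections of `P ×^G V`. -/
def Sections (V : FinRep G) (P : Torsor G A) : Type (u + 1) := V.sectionsAddSubgroup P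

namespace Sections

variable {V W : FinRep G} {P : Torsor G A}

instance : AddCommGroup (V.Sections P) :=
  inferInstanceAs (AddCommGroup (V.sectionsAddSubgroup P))

/-- The value of a section at a point of the torsor. -/
def val (s : V.Sections P) {B : CommAlgCat.{u} k} {b : A ⟶ B} (p : P.pt b) : B ⊗[k] V.V :=
  s.1 p

@[ext]
theorem ext {s t : V.Sections P}
    (h : ∀ {B : CommAlgCat.{u} k} {b : A ⟶ B} (p : P.pt b), s.val p = t.val p) : s = t :=
  Subtype.ext (by funext B b p; exact h p)

theorem val_map (s : V.Sections P) {B C : CommAlgCat.{u} k} {b : A ⟶ B} {c : A ⟶ C} (f : B ⟶ C)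
    (hf : b ≫ f = c) (p : P.pt b) : s.val (P.map f hf p) = bc V.V f (s.val p) := s.2.1 f hf p

theorem val_act (s : V.Sections P) {B : CommAlgCat.{u} k} {b : A ⟶ B} (p : P.pt b) (g : G.obj B) :
    s.val (P.act p g) = V.ρ B g⁻¹ (s.val p) := s.2.2 p g

@[simp]
theorem val_zero {B : CommAlgCat.{u} k} {b : A ⟶ B} (p : P.pt b) : (0 : V.Sections P).val p = 0 :=
  rfl

@[simp]
theorem val_add (s t : V.Sections P) {B : CommAlgCat.{u} k} {b : A ⟶ B} (p : P.pt b) :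
    (s + t).val p = s.val p + t.val p := rfl

instance : SMul A (V.Sections P) where
  smul a s := ⟨fun {B b} p => b.hom a • s.val p,
    fun {B C b c} f hf p => by
      beta_reduce
      rw [val_map, bc_smul, ← hf]
      rfl,
    fun p g => by beta_reduce; rw [val_act, map_smul]⟩

@[simp]
theorem val_smul (a : A) (s : V.Sections P) {B : CommAlgCat.{u} k} {b : A ⟶ B} (p : P.pt b) :
    (a • s).val p = b.hom a • s.val p := rfl

instance : Module A (V.Sections P) where
  one_smul s := by ext; simp
  mul_smul a b s := by ext; simp [mul_smul]
  smul_zero a := by ext; simp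
  smul_add a s t := by ext; simp
  add_smul a b s := by ext; simp [add_smul]
  zero_smul s := by ext; simp

/-- The pullback of sections along an isomorphism of `P'` with a base change of `P`. -/
def pull {A' : CommAlgCat.{u} k} {f : A ⟶ A'} {P' : Torsor G A'} (e : Torsor.IsoOver f P' P)
    (s : V.Sections P) : V.Sections P' :=
  ⟨fun {B b'} p => s.val (e.equiv (b := f ≫ b') rfl p),
    fun {B C b c} g hg p => by
      beta_reduce
      rw [e.natural rfl rfl g hg (by rw [Category.assoc, hg]), val_map],
    fun p g => by beta_reduce; rw [e.equivariant, val_act]⟩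

@[simp]
theorem val_pull {A' : CommAlgCat.{u} k} {f : A ⟶ A'} {P' : Torsor G A'}
    (e : Torsor.IsoOver f P' P) (s : V.Sections P) {B : CommAlgCat.{u} k} {b' : A' ⟶ B}
    (p : P'.pt b') : (pull e s).val p = s.val (e.equiv (b := f ≫ b') rfl p) := rfl

/-- The linear map on sections induced by a morphism of representations. -/
def pushRep (φ : V ⟶ W) : V.Sections P →ₗ[A] W.Sections P where
  toFun s := ⟨fun {B b} p => (FinRep.Hom.lin φ).baseChange B (s.val p),
    fun {B C b c} f hf p => by
      beta_reduce
      rw [val_map]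
      generalize s.val p = x
      induction x with
      | zero => simp
      | tmul a v => simp [bc]
      | add x y hx hy => simp only [map_add, hx, hy],
    fun p g => by beta_reduce; rw [val_act]; exact FinRep.Hom.equivariant φ _ _ _⟩
  map_add' s t := by ext B b p; exact map_add _ _ _
  map_smul' a s := by ext B b p; exact map_smul _ _ _

@[simp]
theorem val_pushRep (φ : V ⟶ W) (s : V.Sections P) {B : CommAlgCat.{u} k} {b : A ⟶ B}
    (p : P.pt b) : (pushRep φ s).val p = (FinRep.Hom.lin φ).baseChange B (s.val p) := rfl

end Sections

theorem Sections.val_congr {V : FinRep G} {P : Torsor G A} (s : V.Sections P)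
    {B : CommAlgCat.{u} k} {b c : A ⟶ B} (h : b ≫ 𝟙 B = c) (p : P.pt b) :
    s.val (P.map (𝟙 B) h p) = s.val p := by
  obtain rfl : b = c := by rw [← h, Category.comp_id]
  rw [P.map_id]

/-- The presheaf of abelian groups underlying the vector bundle on `*/G` defined by `V`. -/
def abOnBG (V : FinRep G) : (QuotStack (GSpace.point.{u, w} G))ᵒᵖ ⥤ Ab.{u + 1} where
  obj x := AddCommGrpCat.of (V.Sections x.unop.torsor)
  map α := AddCommGrpCat.ofHom
    { toFun := Sections.pull (QuotStack.Hom.iso α.unop)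
      map_zero' := rfl
      map_add' := fun _ _ => rfl }
  map_id x := by
    ext s B b p
    exact Sections.val_congr (P := x.unop.torsor) s _ p
  map_comp {x y z} α β := by
    ext s B b p
    have key : ∀ {c d : x.unop.ring ⟶ B} (q : y.unop.torsor.pt (QuotStack.Hom.base β.unop ≫ b))
        (hc : QuotStack.Hom.base α.unop ≫ QuotStack.Hom.base β.unop ≫ b = c)
        (hd : QuotStack.Hom.base α.unop ≫ QuotStack.Hom.base β.unop ≫ b = d),
        s.val ((QuotStack.Hom.iso α.unop).equiv hc q) =
          s.val ((QuotStack.Hom.iso α.unop).equiv hd q) := by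
      intro c d q hc hd
      subst hc hd
      rfl
    exact key _ _ _

instance (V : FinRep G) (x : (QuotStack (GSpace.point.{u, w} G))ᵒᵖ) :
    Module ((QuotStack.structureSheaf (GSpace.point.{u, w} G) ⋙
      forget₂ CommRingCat RingCat).obj x) (V.abOnBG.obj x) :=
  inferInstanceAs (Module x.unop.ring (V.Sections x.unop.torsor))

/-- The functor sending a representation `V` of `G` to the associated vector bundle on `*/G`. -/
def onBG (G : CommAlgCat.{u} k ⥤ GrpCat.{u}) : FinRep G ⥤ QuotStack.Mod (GSpace.point.{u, w} G) where
  obj V := PresheafOfModules.ofPresheaf V.abOnBG fun x y α r m => by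
    refine Sections.ext fun {B b} p => ?_
    rfl
  map {V W} φ := PresheafOfModules.homMk
    { app := fun x => AddCommGrpCat.ofHom
        (Sections.pushRep (P := x.unop.torsor) φ).toAddMonoidHom
      naturality := fun x y α => by
        ext s
        refine Sections.ext fun {B b} p => ?_
        rfl }
    fun x r m => map_smul (Sections.pushRep (P := x.unop.torsor) φ) _ _
  map_id V := by
    ext x s
    refine Sections.ext fun {B b} p => ?_
    change LinearMap.baseChange B LinearMap.id (Sections.val s p) = Sections.val s p
    simp
  map_comp {U V W} φ ψ := by
    ext x s
    refine Sections.ext fun {B b} p => ?_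
    change LinearMap.baseChange B ((Hom.lin ψ) ∘ₗ (Hom.lin φ)) (Sections.val s p) = _
    rw [LinearMap.baseChange_comp]
    rfl

/-- The functor `V ↦ Ṽ`, the pullback along `[X/G] ⟶ */G` of the vector bundle defined by `V`. -/
def tilde (X : GSpace.{u, w} G) : FinRep G ⥤ QuotStack.Mod X :=
  onBG G ⋙ QuotStack.pullbackBG X

end FinRep

/-- A module over the structure sheaf of `[X/G]` is a vector bundle if all its modules of sections
are finite locally free and are compatible with base change. -/
def IsVectorBundle {G : CommAlgCat.{u} k ⥤ GrpCat.{u}} {X : GSpace.{u, w} G}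
    (M : QuotStack.Mod X) : Prop :=
  (∀ x, Module.Finite ((QuotStack.structureSheaf X).obj x) (M.obj x)) ∧
  (∀ x, Module.Projective ((QuotStack.structureSheaf X).obj x) (M.obj x)) ∧
  ∀ {x y : (QuotStack X)ᵒᵖ} (α : x ⟶ y),
    letI : Algebra ((QuotStack.structureSheaf X).obj x) ((QuotStack.structureSheaf X).obj y) :=
      ((QuotStack.structureSheaf X).map α).hom.toAlgebra
    letI : Module ((QuotStack.structureSheaf X).obj x) (M.obj y) :=
      Module.compHom (M.obj y) ((QuotStack.structureSheaf X).map α).hom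
    haveI : IsScalarTower ((QuotStack.structureSheaf X).obj x)
      ((QuotStack.structureSheaf X).obj y) (M.obj y) := ⟨fun _ b m => mul_smul _ b m⟩
    IsBaseChange ((QuotStack.structureSheaf X).obj y)
      ({ toFun := fun m => M.map α m
         map_add' := fun m n => map_add (M.map α).hom m n
         map_smul' := fun a m => M.map_smul α a m } :
        M.obj x →ₗ[(QuotStack.structureSheaf X).obj x] M.obj y)

section Induction

variable {G H : CommAlgCat.{u} k ⥤ GrpCat.{u}} {A : CommAlgCat.{u} k}

theorem Torsor.act_injective (P : Torsor H A) {B : CommAlgCat.{u} k} {b : A ⟶ B} (p : P.pt b)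
    {g h : H.obj B} (e : P.act p g = P.act p h) : g = h :=
  (P.transitive p (P.act p h)).unique e rfl

/-- The unique `h` with `p' = p h`. -/
def Torsor.diff (P : Torsor H A) {B : CommAlgCat.{u} k} {b : A ⟶ B} (p p' : P.pt b) : H.obj B :=
  (P.transitive p p').choose

theorem Torsor.act_diff (P : Torsor H A) {B : CommAlgCat.{u} k} {b : A ⟶ B} (p p' : P.pt b) :
    P.act p (P.diff p p') = p' :=
  (P.transitive p p').choose_spec.1

/-- The points over `b : A ⟶ B` of the torsor `P ×^H G` induced from an `H`-torsor `P` along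
`i : H ⟶ G`: the maps `s : P ⟶ G` over `B` with `s(p h) = i(h)⁻¹ s(p)`, where `s` stands for the
point `[p, s(p)]`. -/
@[ext]
structure IndPt (i : H ⟶ G) (P : Torsor H A) {B : CommAlgCat.{u} k} (b : A ⟶ B) where
  val : ∀ {C : CommAlgCat.{u} k} {c : A ⟶ C} (f : B ⟶ C), b ≫ f = c → P.pt c → G.obj C
  natural : ∀ {C D : CommAlgCat.{u} k} {c : A ⟶ C} {d : A ⟶ D} (f : B ⟶ C) (g : C ⟶ D)
    (hc : b ≫ f = c) (hg : c ≫ g = d) (hd : b ≫ f ≫ g = d) (p : P.pt c),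
    val (f ≫ g) hd (P.map g hg p) = G.map g (val f hc p)
  equivariant : ∀ {C : CommAlgCat.{u} k} {c : A ⟶ C} (f : B ⟶ C) (hc : b ≫ f = c) (p : P.pt c)
    (h : H.obj C), val f hc (P.act p h) = (i.app C h)⁻¹ * val f hc p

namespace IndPt

variable {i : H ⟶ G} {P : Torsor H A}

theorem ext' {B : CommAlgCat.{u} k} {b : A ⟶ B} {s t : IndPt i P b}
    (h : ∀ {C : CommAlgCat.{u} k} {c : A ⟶ C} (f : B ⟶ C) (hc : b ≫ f = c) (p : P.pt c),
      s.val f hc p = t.val f hc p) : s = t := by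
  apply IndPt.ext
  funext C c f hc p
  exact h f hc p

/-- The image of a point under base change. -/
@[simps]
def map {B C : CommAlgCat.{u} k} {b : A ⟶ B} {c : A ⟶ C} (f : B ⟶ C) (hf : b ≫ f = c)
    (s : IndPt i P b) : IndPt i P c where
  val g hd p := s.val (f ≫ g) (by rw [← hd, ← hf, Category.assoc]) p
  natural g g' hd hg hd' p := by
    have h1 := s.natural (f ≫ g) g' (by rw [← hd, ← hf, Category.assoc]) hg
      (by rw [← hd', ← hf]; simp) p
    rw [← h1]
    congr 1
  equivariant g hd p h := s.equivariant _ _ p h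

/-- The right action of `G`. -/
@[simps]
def act {B : CommAlgCat.{u} k} {b : A ⟶ B} (s : IndPt i P b) (g : G.obj B) : IndPt i P b where
  val f hc p := s.val f hc p * G.map f g
  natural f f' hc hg hd p := by rw [s.natural f f' hc hg hd p]; simp
  equivariant f hc p h := by rw [s.equivariant, mul_assoc]

/-- The point `[p, 1]` of `P ×^H G`. -/
def ofPt {B : CommAlgCat.{u} k} {b : A ⟶ B} (p : P.pt b) : IndPt i P b where
  val f hc p' := (i.app _ (P.diff (P.map f hc p) p'))⁻¹
  natural := by
    intro C D c d f g hc hg hd p'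
    have h1 : P.diff (P.map (f ≫ g) hd p) (P.map g hg p') =
        H.map g (P.diff (P.map f hc p) p') := by
      apply P.act_injective (P.map (f ≫ g) hd p)
      rw [P.act_diff, P.map_comp f g hc hg hd, ← P.map_act, P.act_diff]
    rw [h1, map_inv, NatTrans.naturality_apply]
  equivariant := by
    intro C c f hc p' h
    have h1 : P.diff (P.map f hc p) (P.act p' h) = P.diff (P.map f hc p) p' * h := by
      apply P.act_injective (P.map f hc p)
      rw [P.act_diff, P.act_mul, P.act_diff]
    rw [h1, map_mul, mul_inv_rev]

end IndPt

/-- The `G`-torsor `P ×^H G` induced from an `H`-torsor `P` along `i : H ⟶ G`. -/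
def Torsor.induce (i : H ⟶ G) (hG : (grpPsh G).IsSheaf) (P : Torsor H A) : Torsor G A where
  pt b := IndPt i P b
  map := IndPt.map
  map_id h s := IndPt.ext' fun f hc p => by simp [Category.id_comp]
  map_comp f g hf hg h s := IndPt.ext' fun f' hc p => by simp [Category.assoc]
  act := IndPt.act
  act_one s := IndPt.ext' fun f hc p => by simp
  act_mul s g h := IndPt.ext' fun f hc p => by simp [mul_assoc]
  map_act f hf s g := IndPt.ext' fun f' hc p => by simp
  transitive {B b} s t := by
    have key := grp_descend hG (B := B)
      (fun {C} f x => ∃ p : P.pt (b ≫ f), x = (s.val f rfl p)⁻¹ * t.val f rfl p)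
      (by
        rintro C D f g x ⟨p, rfl⟩
        refine ⟨P.map g (Category.assoc _ _ _) p, ?_⟩
        rw [s.natural f g rfl _ _ p, t.natural f g rfl _ _ p]
        simp)
      (by
        rintro C f x y ⟨p, rfl⟩ ⟨p', rfl⟩
        rw [← P.act_diff p p', s.equivariant, t.equivariant]
        simp)
      (by
        obtain ⟨C, f, hf, ⟨p⟩⟩ := P.locally_nonempty b
        exact ⟨C, f, _, hf, p, rfl⟩)
    obtain ⟨g, hg, hg'⟩ := key
    refine ⟨g, IndPt.ext' fun {C c} f hc p => ?_, fun g' h => hg' g' fun {C} f x hx => ?_⟩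
    · subst hc
      have := hg f _ ⟨p, rfl⟩
      simp [this]
    · obtain ⟨p, rfl⟩ := hx
      rw [← h]
      simp
  locally_nonempty {B} b := by
    obtain ⟨C, f, hf, ⟨p⟩⟩ := P.locally_nonempty b
    exact ⟨C, f, hf, ⟨IndPt.ofPt p⟩⟩
  glue {B C b c} f hf hff s hs := by
    have hval : ∀ {D : CommAlgCat.{u} k} {d : A ⟶ D} (g : B ⟶ D) (hd : b ≫ g = d) (p : P.pt d),
        ∃! x : G.obj D, ∀ {E : CommAlgCat.{u} k} {d' : A ⟶ E} (e : D ⟶ E) (c' : C ⟶ E)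
          (_ : f ≫ c' = g ≫ e) (h : d ≫ e = d') (h' : c ≫ c' = d'),
          G.map e x = s.val c' h' (P.map e h p) := by
      intro D d g hd p
      have key := grp_descend hG (B := D)
        (fun {E} e x => ∃ (c' : C ⟶ E) (_ : f ≫ c' = g ≫ e) (h' : c ≫ c' = d ≫ e),
          x = s.val c' h' (P.map e rfl p))
        (by
          rintro E E' e e' _ ⟨c', h, h', rfl⟩
          have h2 : c ≫ c' ≫ e' = d ≫ e ≫ e' := by
            rw [← Category.assoc, h', Category.assoc]
          refine ⟨c' ≫ e', by rw [← Category.assoc, h, Category.assoc], h2, ?_⟩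
          have h1 := s.natural c' e' h' (Category.assoc _ _ _) h2 (P.map e rfl p)
          rw [P.map_comp e e' rfl (Category.assoc _ _ _) rfl]
          exact h1.symm)
        (by
          rintro E e _ _ ⟨c₁, h₁, h₁', rfl⟩ ⟨c₂, h₂, h₂', rfl⟩
          have h1 := hs c₁ c₂ h₁' h₂' (h₁.trans h₂.symm)
          have h2 := congrArg (fun t : IndPt i P (d ≫ e) =>
            t.val (𝟙 E) (Category.comp_id _) (P.map e rfl p)) h1
          simpa using h2)
        (by
          obtain ⟨E, c', e, h, he⟩ := isFppf_pushout hff g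
          exact ⟨E, e, _, he, c', h, by rw [← hf, ← hd, Category.assoc, h, Category.assoc], rfl⟩)
      obtain ⟨x, hx, hx'⟩ := key
      refine ⟨x, fun {E d'} e c' h hd' h' => ?_, fun y hy => hx' y ?_⟩
      · subst hd'
        exact hx e _ ⟨c', h, h', rfl⟩
      · rintro E e _ ⟨c', h, h', rfl⟩
        exact hy e c' h rfl h'
    refine ⟨⟨fun {D d} g hd p => (hval g hd p).choose, ?_, ?_⟩, ?_, ?_⟩
    · intro D D' d d' g g' hd hg' hd' p
      refine ((hval (g ≫ g') hd' (P.map g' hg' p)).choose_spec.2 _ ?_).symm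
      intro E d'' e c' h h1 h2
      have h3 := (hval g hd p).choose_spec.1 (g' ≫ e) c' (by rw [h, Category.assoc])
        (by rw [← Category.assoc, hg', h1]) h2
      rw [P.map_comp g' e hg' h1] at h3
      rw [← h3]
      simp
    · intro D d g hd p h
      refine ((hval g hd (P.act p h)).choose_spec.2 _ ?_).symm
      intro E d'' e c' h0 h1 h2
      have h3 := (hval g hd p).choose_spec.1 e c' h0 h1 h2
      rw [P.map_act, s.equivariant, ← h3, map_mul, map_inv, NatTrans.naturality_apply]
    · refine IndPt.ext' fun {D d} g hd p => ?_
      have h3 := (hval (f ≫ g) (by rw [← hd, ← hf, Category.assoc]) p).choose_spec.1 (𝟙 D) g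
        (Category.comp_id _).symm (Category.comp_id _) hd
      rw [P.map_id] at h3
      simpa using h3
    · intro t ht
      refine IndPt.ext' fun {D d} g hd p => ?_
      refine (hval g hd p).choose_spec.2 _ ?_
      intro E d' e c' h h1 h2
      rw [← t.natural g e hd h1 (by rw [← h1, ← hd, Category.assoc]) p]
      have h4 := congrArg (fun t : IndPt i P c => t.val c' h2 (P.map e h1 p)) ht
      rw [← h4]
      simp [h]

/-- The map `P ⟶ P ×^H G`, `p ↦ [p, 1]`. -/
def Torsor.toInduce (i : H ⟶ G) (hG : (grpPsh G).IsSheaf) (P : Torsor H A)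
    {B : CommAlgCat.{u} k} {b : A ⟶ B} (p : P.pt b) : (P.induce i hG).pt b :=
  IndPt.ofPt p

theorem Torsor.IsoOver.symm_map {A' : CommAlgCat.{u} k} {f : A ⟶ A'} {P' : Torsor H A'}
    {P : Torsor H A} (e : Torsor.IsoOver f P' P) {B C : CommAlgCat.{u} k} {b' : A' ⟶ B}
    {b : A ⟶ B} {c' : A' ⟶ C} {c : A ⟶ C} (hb : f ≫ b' = b) (hc : f ≫ c' = c) (g : B ⟶ C)
    (hg' : b' ≫ g = c') (hg : b ≫ g = c) (p : P.pt b) :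
    (e.equiv hc).symm (P.map g hg p) = P'.map g hg' ((e.equiv hb).symm p) := by
  rw [Equiv.symm_apply_eq, e.natural hb hc g hg' hg, Equiv.apply_symm_apply]

theorem Torsor.IsoOver.symm_act {A' : CommAlgCat.{u} k} {f : A ⟶ A'} {P' : Torsor H A'}
    {P : Torsor H A} (e : Torsor.IsoOver f P' P) {B : CommAlgCat.{u} k} {b' : A' ⟶ B}
    {b : A ⟶ B} (hb : f ≫ b' = b) (p : P.pt b) (h : H.obj B) :
    (e.equiv hb).symm (P.act p h) = P'.act ((e.equiv hb).symm p) h := by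
  rw [Equiv.symm_apply_eq, e.equivariant hb, Equiv.apply_symm_apply]

/-- The isomorphism of induced torsors defined by an isomorphism of torsors. -/
def Torsor.IsoOver.induce (i : H ⟶ G) (hG : (grpPsh G).IsSheaf) {A' : CommAlgCat.{u} k}
    {f : A ⟶ A'} {P' : Torsor H A'} {P : Torsor H A} (e : Torsor.IsoOver f P' P) :
    Torsor.IsoOver f (P'.induce i hG) (P.induce i hG) where
  equiv {B b' b} hb :=
    { toFun := fun (s : IndPt i P' b') =>
        ({ val := fun {C c} g hc p => s.val g rfl ((e.equiv (b' := b' ≫ g)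
            (by rw [← hc, ← hb, Category.assoc])).symm p)
           natural := by
            intro C D c d g g' hc hg hd p
            rw [e.symm_map (b' := b' ≫ g) (by rw [← hc, ← hb, Category.assoc]) _ g'
              (Category.assoc _ _ _) hg, s.natural g g' rfl]
           equivariant := by
            intro C c g hc p h
            rw [e.symm_act, s.equivariant] } : IndPt i P b)
      invFun := fun (s : IndPt i P b) =>
        ({ val := fun {C c} g hc p => s.val g (by rw [← hc, ← hb, Category.assoc])
            (e.equiv (b := f ≫ c) rfl p)
           natural := by
            intro C D c d g g' hc hg hd p
            rw [e.natural rfl rfl g' hg (by rw [Category.assoc, hg]), s.natural g g']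
           equivariant := by
            intro C c g hc p h
            rw [e.equivariant, s.equivariant] } : IndPt i P' b')
      left_inv := fun s => IndPt.ext' fun g hc p => by
        subst hc
        simp
      right_inv := fun s => IndPt.ext' fun {C c} g hc p => by
        have : ∀ {c' : A ⟶ C} (h1 : f ≫ b' ≫ g = c') (h2 : b ≫ g = c') (h3 : f ≫ b' ≫ g = c),
            s.val g h2 (e.equiv h1 ((e.equiv h3).symm p)) = s.val g hc p := by
          intro c' h1 h2 h3
          obtain rfl : c = c' := h3.symm.trans h1
          rw [Equiv.apply_symm_apply]
        exact this _ _ _ }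
  natural := by
    intro B C b' b c' c hb hc g hg' hg s
    refine IndPt.ext' fun {D d} g' hd p => ?_
    have : ∀ {d' d'' : A' ⟶ D} (h : d' = d'') (h1 : b' ≫ g ≫ g' = d') (h1' : b' ≫ g ≫ g' = d'')
        (h2 : f ≫ d' = d) (h2' : f ≫ d'' = d),
        IndPt.val s (g ≫ g') h1 ((e.equiv h2).symm p) =
          IndPt.val s (g ≫ g') h1' ((e.equiv h2').symm p) := by
      intro d' d'' h h1 h1' h2 h2'
      subst h
      rfl
    exact this (by rw [← hg', Category.assoc]) _ _ _ _
  equivariant := by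
    intro B b' b hb s g
    exact IndPt.ext' fun {D d} g' hd p => rfl

/-- A map `X ⟶ Y` of spaces that is equivariant along `i : H ⟶ G`. -/
structure GSpace.MapAlong (i : H ⟶ G) (X : GSpace.{u, w} H) (Y : GSpace.{u, w'} G) where
  app : ∀ {A : CommAlgCat.{u} k}, X.obj A → Y.obj A
  natural : ∀ {A B : CommAlgCat.{u} k} (f : A ⟶ B) (x : X.obj A), app (X.map f x) = Y.map f (app x)
  equivariant : ∀ {A : CommAlgCat.{u} k} (h : H.obj A) (x : X.obj A),
    app (X.smul h x) = Y.smul (i.app A h) (app x)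

/-- The point `g⁻¹ • ψ(φ(p))` of `Y` attached to the point `[p, g]` of `P ×^H G`, where
`φ : P ⟶ X` is the given equivariant map. -/
theorem GSpace.MapAlong.existsUnique_toSpace {i : H ⟶ G} {X : GSpace.{u, w} H}
    {Y : GSpace.{u, w'} G} (ψ : GSpace.MapAlong i X Y) (hY : Y.toPsh.IsSheaf) (x : QuotStack X)
    {B : CommAlgCat.{u} k} {b : x.ring ⟶ B} (s : IndPt i x.torsor b) :
    ∃! y : Y.obj B, ∀ {C : CommAlgCat.{u} k} {c : x.ring ⟶ C} (f : B ⟶ C) (hc : b ≫ f = c)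
      (p : x.torsor.pt c), Y.map f y = Y.smul (s.val f hc p)⁻¹ (ψ.app (x.toSpace p)) := by
  have key := hY.descend (B := B)
    (fun {C} f y => ∃ p : x.torsor.pt (b ≫ f),
      y = Y.smul (s.val f rfl p)⁻¹ (ψ.app (x.toSpace p)))
    (by
      rintro C D f g _ ⟨p, rfl⟩
      refine ⟨x.torsor.map g (Category.assoc _ _ _) p, ?_⟩
      rw [s.natural f g rfl _ _ p, x.natural, ψ.natural, Y.map_smul, map_inv])
    (by
      rintro C f _ _ ⟨p, rfl⟩ ⟨p', rfl⟩
      rw [← x.torsor.act_diff p p', s.equivariant, x.equivariant, ψ.equivariant, ← Y.mul_smul]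
      simp)
    (by
      obtain ⟨C, f, hf, ⟨p⟩⟩ := x.torsor.locally_nonempty b
      exact ⟨C, f, _, hf, p, rfl⟩)
  obtain ⟨y, hy, hy'⟩ := key
  refine ⟨y, fun {C c} f hc p => ?_, fun z hz => hy' z ?_⟩
  · subst hc
    exact hy f _ ⟨p, rfl⟩
  · rintro C f _ ⟨p, rfl⟩
    exact hz f rfl p

namespace QuotStack

variable (i : H ⟶ G) (hG : (grpPsh G).IsSheaf) {X : GSpace.{u, w} H}
  {Y : GSpace.{u, w'} G} (ψ : GSpace.MapAlong i X Y) (hY : Y.toPsh.IsSheaf)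

/-- The object of `[Y/G]` attached to an object `(P, φ : P ⟶ X)` of `[X/H]`: the induced torsor
`P ×^H G` with the equivariant map `[p, g] ↦ g⁻¹ • ψ(φ(p))`. -/
def mapAlongObj (x : QuotStack X) : QuotStack Y where
  ring := x.ring
  torsor := x.torsor.induce i hG
  toSpace := fun s => (ψ.existsUnique_toSpace hY x s).choose
  natural := fun {B C b c} f hf s => by
    refine ((ψ.existsUnique_toSpace hY x _).choose_spec.2 _ ?_).symm
    intro D d g hd p
    rw [← Y.map_comp]
    exact (ψ.existsUnique_toSpace hY x s).choose_spec.1 (f ≫ g) _ p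
  equivariant := fun {B b} s g => by
    refine ((ψ.existsUnique_toSpace hY x _).choose_spec.2 _ ?_).symm
    intro D d f hd p
    rw [Y.map_smul, (ψ.existsUnique_toSpace hY x s).choose_spec.1 f hd p, ← Y.mul_smul,
      map_inv, ← mul_inv_rev]
    rfl

/-- The action of `mapAlongObj` on morphisms. -/
def mapAlongHom {x y : QuotStack X} (α : Hom x y) :
    Hom (mapAlongObj i hG ψ hY x) (mapAlongObj i hG ψ hY y) where
  base := α.base
  iso := α.iso.induce i hG
  toSpace := fun {B b' b} hb s => by
    refine (ψ.existsUnique_toSpace hY x s).choose_spec.2 _ ?_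
    intro C c f hc p
    have h1 := (ψ.existsUnique_toSpace hY y
      ((α.iso.induce i hG).equiv hb s)).choose_spec.1 f
      (by rw [← hb]; exact (Category.assoc _ _ _).trans (congrArg _ hc)) (α.iso.equiv (b := α.base ≫ c) rfl p)
    rw [α.toSpace] at h1
    refine h1.trans ?_
    subst hc
    congr 2
    exact congrArg (IndPt.val s f rfl) (Equiv.symm_apply_apply _ _)

/-- The morphism of quotient stacks `[X/H] ⟶ [Y/G]` defined by a map `ψ : X ⟶ Y` that is
equivariant along `i : H ⟶ G`. -/
def mapAlong : QuotStack X ⥤ QuotStack Y where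
  obj := mapAlongObj i hG ψ hY
  map := mapAlongHom i hG ψ hY
  map_id x := by
    refine Hom.ext' rfl ?_
    intro B b' b hα hβ s
    obtain rfl : b' = b := by rw [← hβ]; exact (Category.id_comp _).symm
    refine IndPt.ext' fun {C c} f hc p => ?_
    subst hc
    have h1 := IndPt.natural s f (𝟙 C) rfl (Category.comp_id _) (by simp) p
    change IndPt.val s f rfl (x.torsor.map (𝟙 C) (Category.comp_id _) p) =
      IndPt.val s (𝟙 B ≫ f) _ p
    rw [x.torsor.map_id]
    congr 1
  map_comp {x y z} α β := by
    refine Hom.ext' rfl ?_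
    intro B b' b hα hβ s
    refine IndPt.ext' fun {C c} f hc p => ?_
    have : ∀ {d d' : y.ring ⟶ C} (h : d = d') (h1 : Hom.base α ≫ (b' : x.ring ⟶ B) ≫ f = d)
        (h1' : Hom.base α ≫ (b' : x.ring ⟶ B) ≫ f = d') (h2 : Hom.base β ≫ d = c)
        (h2' : Hom.base β ≫ d' = c),
        IndPt.val s f rfl (((Hom.iso α).equiv h1).symm (((Hom.iso β).equiv h2).symm p)) =
          IndPt.val s f rfl (((Hom.iso α).equiv h1').symm (((Hom.iso β).equiv h2').symm p)) := by
      intro d d' h h1 h1' h2 h2'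
      subst h
      rfl
    have h1 : Hom.base α ≫ (b' : x.ring ⟶ B) ≫ f = (Hom.base α ≫ b') ≫ f :=
      (Category.assoc _ _ _).symm
    have h2 : Hom.base β ≫ Hom.base α ≫ (b' : x.ring ⟶ B) ≫ f = c := by
      rw [← hc, ← hα]
      exact ((Category.assoc _ _ _).trans (Category.assoc _ _ _)).symm
    exact this h1 rfl h1 h2 (h1 ▸ h2)

/-- Pullback of modules along `[X/H] ⟶ [Y/G]`. -/
def pullbackAlong : Mod Y ⥤ Mod X :=
  PresheafOfModules.pushforward₀OfCommRingCat (mapAlong i hG ψ hY) (structureSheaf Y)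

end QuotStack

end Induction

end Stacks
section Galois

variable (F : Type*) [Field F] [ValuativeRel F] [TopologicalSpace F]
  [IsNonarchimedeanLocalField F]

/-- The absolute Galois group `Γ_F = Aut(F̄/F)`, with its Krull topology. -/
abbrev AbsGal : Type _ := AlgebraicClosure F ≃ₐ[F] AlgebraicClosure F

/-- The ring of integers of `F̄`. -/
abbrev IntBar : Type _ := integralClosure 𝒪[F] (AlgebraicClosure F)

/-- The maximal ideal of the (local) ring of integers of `F̄`, as its Jacobson radical. -/
def maxBar : Ideal (IntBar F) := Ideal.jacobson ⊥

/-- The residue cardinality `q`. -/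
def resCard : ℕ := Nat.card 𝓀[F]

/-- The residue characteristic `p`. -/
def resChar : ℕ := ringChar 𝓀[F]

/-- The base ring `ℤ[1/p]`. -/
abbrev BaseRing : Type := Localization.Away ((resChar F : ℕ) : ℤ)

theorem isUnit_resCard : IsUnit ((resCard F : ℕ) : BaseRing F) := by
  have : Fintype 𝓀[F] := Fintype.ofFinite _
  obtain ⟨n, -, hn⟩ := FiniteField.card 𝓀[F] (ringChar 𝓀[F])
  have h : resCard F = resChar F ^ (n : ℕ) := by
    rw [resCard, Nat.card_eq_fintype_card, hn]; rfl
  rw [h, Nat.cast_pow]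
  refine IsUnit.pow _ ?_
  have := IsLocalization.Away.algebraMap_isUnit (S := BaseRing F) ((resChar F : ℕ) : ℤ)
  simpa using this

/-- The unit `q` of `ℤ[1/p]`. -/
def qUnit : (BaseRing F)ˣ := (isUnit_resCard F).unit

theorem smul_mem_maxBar {F : Type*} [Field F] [ValuativeRel F] (γ : AbsGal F) {x : IntBar F} (hx : x ∈ maxBar F) :
    γ • x ∈ maxBar F := by
  rw [maxBar, Ideal.mem_jacobson_bot] at hx ⊢
  intro y
  have h := (hx (γ⁻¹ • y)).map (MulSemiringAction.toRingHom (AbsGal F) (IntBar F) γ)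
  simpa using h

/-- The inertia subgroup `I_F`: the automorphisms acting trivially on the residue field. -/
def inertia : Subgroup (AbsGal F) :=
  (maxBar F).toAddSubgroup.inertia (AbsGal F)

instance : (inertia F).Normal where
  conj_mem i hi γ x := by
    have h := smul_mem_maxBar γ (hi (γ⁻¹ • x))
    simpa [mul_smul, smul_sub] using h

/-- The wild inertia subgroup `P_F`: the `γ` with `γ(x)/x ≡ 1` modulo the maximal ideal for all
nonzero `x` in `F̄`. -/
def wildInertia : Subgroup (AbsGal F) where
  carrier := {γ | ∀ x : AlgebraicClosure F, x ≠ 0 → ∃ a ∈ maxBar F, γ x = (1 + a) * x}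
  one_mem' x _ := ⟨0, zero_mem _, by simp⟩
  mul_mem' {γ δ} hγ hδ x hx := by
    obtain ⟨a, ha, h⟩ := hδ x hx
    obtain ⟨b, hb, h'⟩ := hγ (δ x) (by simpa using hx)
    refine ⟨a + b + b * a, add_mem (add_mem ha hb) (Ideal.mul_mem_left _ _ ha), ?_⟩
    rw [AlgEquiv.mul_apply, h', h]
    push_cast
    ring
  inv_mem' {γ} hγ x hx := by
    obtain ⟨a, ha, h⟩ := hγ (γ⁻¹ x) (by simpa using hx)
    obtain ⟨u, hu⟩ := (Ideal.mem_jacobson_bot.mp ha) 1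
    refine ⟨-a * (u⁻¹ : (IntBar F)ˣ), Ideal.mul_mem_right _ _ (neg_mem ha), ?_⟩
    have hu' : (1 + (a : AlgebraicClosure F)) * ((u⁻¹ : (IntBar F)ˣ) : IntBar F) = 1 := by
      have := congrArg (fun z : IntBar F => (z : AlgebraicClosure F)) u.mul_inv
      rw [hu] at this
      simpa [add_comm] using this
    have hx' : x = (1 + (a : AlgebraicClosure F)) * γ⁻¹ x := by
      rw [← h, ← AlgEquiv.mul_apply, mul_inv_cancel, AlgEquiv.one_apply]
    generalize hy : γ⁻¹ x = y at hx' ⊢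
    subst hx'
    push_cast
    linear_combination (a * y) * hu'

instance : (wildInertia F).Normal where
  conj_mem i hi γ x hx := by
    obtain ⟨a, ha, h⟩ := hi (γ⁻¹ x) (by simpa using hx)
    refine ⟨γ • a, smul_mem_maxBar γ ha, ?_⟩
    rw [AlgEquiv.mul_apply, AlgEquiv.mul_apply, h, map_mul, map_add, map_one,
      ← AlgEquiv.mul_apply, mul_inv_cancel, AlgEquiv.one_apply]
    rfl

/-- The choice of a lift `σ` of the arithmetic Frobenius and of a topological generator `τ` of the
tame inertia group `I_F / P_F ⊆ Γ_F / P_F`. -/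
structure TameChoice where
  σ : AbsGal F
  frob : ∀ x : IntBar F, σ • x - x ^ resCard F ∈ maxBar F
  τ : AbsGal F ⧸ wildInertia F
  gen : (Subgroup.zpowers τ).topologicalClosure =
    (inertia F).map (QuotientGroup.mk' (wildInertia F))

variable {F} (c : TameChoice F)

namespace TameChoice

/-- The discretized group `Γ_{F,ι}`: the preimage in `Γ_F` of the subgroup of `Γ_F / P_F`
generated by `σ` and `τ`, that is, the pullback of `Γ_F` along the injection
`ι : ⟨σ, τ ∣ σ τ σ⁻¹ = τ ^ q⟩ ↪ Γ_F / P_F`. -/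
def disc : Subgroup (AbsGal F) :=
  (Subgroup.closure {QuotientGroup.mk' (wildInertia F) c.σ, c.τ}).comap
    (QuotientGroup.mk' (wildInertia F))

theorem wildInertia_le_inertia : wildInertia F ≤ inertia F := by
  intro γ hγ x
  by_cases hx : x = 0
  · simp [hx]
  obtain ⟨a, ha, h⟩ := hγ x (by simpa using hx)
  have : γ • x - x = a * x := by
    apply Subtype.ext
    have h2 : ((γ • x : IntBar F) : AlgebraicClosure F) = (1 + a) * x := h
    push_cast
    rw [h2]
    ring
  rw [this]
  exact Ideal.mul_mem_right _ _ ha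

theorem σ_mem : c.σ ∈ c.disc :=
  Subgroup.subset_closure (Set.mem_insert _ _)

theorem τ_mem : c.τ ∈ (inertia F).map (QuotientGroup.mk' (wildInertia F)) := by
  rw [← c.gen]
  exact Subgroup.le_topologicalClosure _ (Subgroup.mem_zpowers _)

theorem exists_deg (γ : c.disc) : ∃ n : ℤ, (γ : AbsGal F) * c.σ ^ (-n) ∈ inertia F := by
  let π := QuotientGroup.mk' (inertia F)
  have key : c.disc ≤ (Subgroup.zpowers (π c.σ)).comap π := by
    have hle : wildInertia F ≤ π.ker := by
      rw [QuotientGroup.ker_mk']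
      exact wildInertia_le_inertia
    let π' : AbsGal F ⧸ wildInertia F →* AbsGal F ⧸ inertia F :=
      QuotientGroup.lift _ π hle
    have h1 : Subgroup.closure {QuotientGroup.mk' (wildInertia F) c.σ, c.τ} ≤
        (Subgroup.zpowers (π c.σ)).comap π' := by
      rw [Subgroup.closure_le]
      rintro x (rfl | rfl)
      · exact Subgroup.mem_zpowers _
      · obtain ⟨i, hi, hi'⟩ := c.τ_mem
        have : π' c.τ = 1 := by
          rw [← hi']
          exact (QuotientGroup.eq_one_iff i).mpr hi
        change π' c.τ ∈ Subgroup.zpowers (π c.σ)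
        rw [this]
        exact one_mem _
    intro γ hγ
    exact h1 hγ
  obtain ⟨n, hn⟩ := key γ.2
  refine ⟨n, (QuotientGroup.eq_one_iff (N := inertia F) _).mp ?_⟩
  change π (γ * c.σ ^ (-n)) = 1
  rw [map_mul, map_zpow, ← hn]
  simp

theorem frob_pow (n : ℕ) (x : IntBar F) :
    c.σ ^ n • x - x ^ (resCard F ^ n) ∈ maxBar F := by
  induction n with
  | zero => simp
  | succ n ih =>
    have h1 := smul_mem_maxBar c.σ ih
    have h2 := c.frob (x ^ (resCard F ^ n))
    have := add_mem h1 h2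
    rw [pow_succ' c.σ, mul_smul, pow_succ (resCard F), pow_mul]
    convert this using 1
    rw [smul_sub]
    ring

theorem one_lt_resCard : 1 < resCard F := Finite.one_lt_card

theorem infinite_quotient (M : Ideal (IntBar F)) [M.IsMaximal] : Infinite (IntBar F ⧸ M) := by
  let _ := Ideal.Quotient.field M
  have : IsAlgClosed (IntBar F ⧸ M) := by
    refine IsAlgClosed.of_exists_root _ fun f hf hirr => ?_
    obtain ⟨g, hg, hdeg, hmon⟩ := Polynomial.lifts_and_natDegree_eq_and_monic
      (f := Ideal.Quotient.mk M) (p := f)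
      ((Polynomial.mem_lifts _).mpr (Polynomial.map_surjective _ Ideal.Quotient.mk_surjective f)) hf
    have hd : (g.map (algebraMap (IntBar F) (AlgebraicClosure F))).degree ≠ 0 := by
      rw [hmon.degree_map]
      intro h0
      have h1 := Polynomial.natDegree_eq_of_degree_eq_some h0
      rw [hdeg] at h1
      exact hirr.natDegree_pos.ne' h1
    obtain ⟨z, hz⟩ := IsAlgClosed.exists_root _ hd
    have hzS : IsIntegral (IntBar F) z :=
      ⟨g, hmon, by rwa [Polynomial.IsRoot.def, Polynomial.eval_map] at hz⟩
    have hzO : IsIntegral 𝒪[F] z := isIntegral_trans z hzS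
    refine ⟨Ideal.Quotient.mk M ⟨z, hzO⟩, ?_⟩
    rw [← hg, Polynomial.eval_map, Polynomial.eval₂_hom]
    have : g.eval (⟨z, hzO⟩ : IntBar F) = 0 := by
      apply Subtype.ext
      rw [Polynomial.IsRoot.def, Polynomial.eval_map] at hz
      have h2 := Polynomial.eval₂_hom (p := g) (algebraMap (IntBar F) (AlgebraicClosure F))
        (⟨z, hzO⟩ : IntBar F)
      exact h2.symm.trans hz
    rw [this, map_zero]
  exact IsAlgClosed.instInfinite

theorem deg_unique {n : ℤ} (h : c.σ ^ n ∈ inertia F) : n = 0 := by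
  wlog hn : 0 ≤ n generalizing n
  · have := this (n := -n) (by rw [zpow_neg]; exact inv_mem h) (by omega)
    omega
  by_contra hne
  obtain ⟨m, rfl⟩ := Int.eq_ofNat_of_zero_le hn
  have hm : m ≠ 0 := by rintro rfl; simp at hne
  rw [zpow_natCast] at h
  obtain ⟨M, hM⟩ := Ideal.exists_maximal (IntBar F)
  have hle : maxBar F ≤ M := sInf_le ⟨bot_le, hM⟩
  let _ := Ideal.Quotient.field M
  have := infinite_quotient M
  have hN : 1 < resCard F ^ m := Nat.one_lt_pow hm one_lt_resCard
  have hroot : ∀ y : IntBar F ⧸ M, y ^ (resCard F ^ m) - y = 0 := by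
    intro y
    obtain ⟨x, rfl⟩ := Ideal.Quotient.mk_surjective y
    have h1 : c.σ ^ m • x - x - (c.σ ^ m • x - x ^ resCard F ^ m) ∈ maxBar F :=
      sub_mem (h x) (c.frob_pow m x)
    have h2 : x ^ (resCard F ^ m) - x ∈ M := by
      refine hle ?_
      convert h1 using 1
      ring
    rw [← map_pow, ← map_sub]
    exact Ideal.Quotient.eq_zero_iff_mem.mpr h2
  have hp : (Polynomial.X ^ (resCard F ^ m) - Polynomial.X : Polynomial (IntBar F ⧸ M)) = 0 :=
    Polynomial.eq_zero_of_infinite_isRoot _ (by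
      have : {x | (Polynomial.X ^ (resCard F ^ m) - Polynomial.X :
        Polynomial (IntBar F ⧸ M)).IsRoot x} = Set.univ := by
        ext y
        simpa using hroot y
      rw [this]
      exact Set.infinite_univ)
  exact FiniteField.X_pow_card_sub_X_ne_zero _ hN hp

/-- The degree `Γ_{F,ι} → ℤ`: an element has degree `n` if it acts on the residue field of `F̄` as
the `n`-th power of the arithmetic Frobenius. -/
def deg (γ : c.disc) : ℤ := (c.exists_deg γ).choose

theorem deg_spec (γ : c.disc) : (γ : AbsGal F) * c.σ ^ (-c.deg γ) ∈ inertia F :=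
  (c.exists_deg γ).choose_spec

theorem deg_eq {γ : c.disc} {n : ℤ} (h : (γ : AbsGal F) * c.σ ^ (-n) ∈ inertia F) :
    c.deg γ = n := by
  have h1 := mul_mem (inv_mem (c.deg_spec γ)) h
  have h2 : c.σ ^ (c.deg γ - n) ∈ inertia F := by
    convert h1 using 1
    rw [mul_inv_rev, mul_assoc, inv_mul_cancel_left, ← zpow_neg, neg_neg, ← zpow_add,
      sub_eq_add_neg]
  have := c.deg_unique h2
  omega

theorem deg_one : c.deg 1 = 0 := c.deg_eq (by simp)

theorem deg_mul (γ δ : c.disc) : c.deg (γ * δ) = c.deg γ + c.deg δ := by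
  apply c.deg_eq
  have h1 := mul_mem (c.deg_spec γ)
    ((inferInstance : (inertia F).Normal).conj_mem _ (c.deg_spec δ) (c.σ ^ c.deg γ))
  convert h1 using 1
  simp only [Subgroup.coe_mul, neg_add, zpow_add, zpow_neg]
  group

theorem deg_σ : c.deg ⟨c.σ, c.σ_mem⟩ = 1 := c.deg_eq (by simp)

theorem deg_inertia {γ : c.disc} (h : (γ : AbsGal F) ∈ inertia F) : c.deg γ = 0 :=
  c.deg_eq (by simpa using h)

variable (Ft : IntermediateField F (AlgebraicClosure F)) [FiniteDimensional F Ft] [IsGalois F Ft]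

/-- The restriction `Γ_F → Gal(F̃/F)`. -/
def restr : AbsGal F →* (Ft ≃ₐ[F] Ft) := AlgEquiv.restrictNormalHom Ft

/-- The character `χ : Γ_{F,ι} → 𝔾ₘ(A) × Gal(F̃/F)`, sending an element `γ` of degree `n` to
`(q ^ (-n), γ|F̃)`. -/
def chi (A : Type*) [CommRing A] [Algebra (BaseRing F) A] : c.disc →* Aˣ × (Ft ≃ₐ[F] Ft) where
  toFun γ := (Units.map (algebraMap (BaseRing F) A) (qUnit F) ^ (-c.deg γ), restr Ft γ)
  map_one' := by simp [deg_one]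
  map_mul' γ δ := by
    rw [deg_mul, neg_add, zpow_add]
    simp

end TameChoice
end Galois

section Parameters

variable {F : Type w} [Field F] [ValuativeRel F] [TopologicalSpace F]
  [IsNonarchimedeanLocalField F]
  (Ft : IntermediateField F (AlgebraicClosure F)) [FiniteDimensional F Ft] [IsGalois F Ft]

/-- An affine group scheme `Ĝ` over `ℤ[1/p]` (a representable group functor) with an action of
`𝔾ₘ × Gal(F̃/F)` by group automorphisms. For the dual group of a reductive group over `F` that
splits over `F̃`, with the Galois action by pinned automorphisms and `𝔾ₘ` acting through the
cocharacter `ρ_ad` of the adjoint group, the semidirect product is the C-group. -/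
structure CGroupDatum where
  grp : CommAlgCat.{u} (BaseRing F) ⥤ GrpCat.{u}
  affine : (grp ⋙ forget GrpCat).IsCorepresentable
  act : ∀ A : CommAlgCat.{u} (BaseRing F), Aˣ × (Ft ≃ₐ[F] Ft) →* MulAut (grp.obj A)
  natural : ∀ {A B : CommAlgCat.{u} (BaseRing F)} (f : A ⟶ B) (t : Aˣ × (Ft ≃ₐ[F] Ft))
    (g : grp.obj A), grp.map f (act A t g) =
      act B (Units.map f.hom.toRingHom t.1, t.2) (grp.map f g)

namespace CGroupDatum

variable {Ft} (D : CGroupDatum.{u} Ft)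

theorem isSheaf : (grpPsh D.grp).IsSheaf :=
  haveI := D.affine
  isSheaf_of_isCorepresentable D.grp

/-- The points `Ĝ(A) ⋊ (𝔾ₘ(A) × Gal(F̃/F))` of the C-group whose component in the constant group
`Gal(F̃/F)` is constant on `Spec A`. All points that occur below lie over such constant elements. -/
abbrev CG (A : CommAlgCat.{u} (BaseRing F)) : Type _ :=
  SemidirectProduct (D.grp.obj A) (Aˣ × (Ft ≃ₐ[F] Ft)) (D.act A)

/-- Functoriality of `𝔾ₘ(A) × Gal(F̃/F)`. -/
def torMap {A B : CommAlgCat.{u} (BaseRing F)} (f : A ⟶ B) :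
    Aˣ × (Ft ≃ₐ[F] Ft) →* Bˣ × (Ft ≃ₐ[F] Ft) :=
  (Units.map f.hom.toRingHom.toMonoidHom).prodMap (MonoidHom.id _)

/-- Functoriality of the points of the C-group. -/
def cgMap {A B : CommAlgCat.{u} (BaseRing F)} (f : A ⟶ B) : D.CG A →* D.CG B :=
  SemidirectProduct.map (D.grp.map f).hom (torMap f) fun t => by
    ext g
    exact D.natural f t g

theorem cgMap_id {A : CommAlgCat.{u} (BaseRing F)} (x : D.CG A) : D.cgMap (𝟙 A) x = x := by
  ext <;> simp [cgMap, torMap]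

theorem cgMap_comp {A B C : CommAlgCat.{u} (BaseRing F)} (f : A ⟶ B) (g : B ⟶ C) (x : D.CG A) :
    D.cgMap (f ≫ g) x = D.cgMap g (D.cgMap f x) := by
  ext <;> simp [cgMap, torMap]

theorem cgMap_inl {A B : CommAlgCat.{u} (BaseRing F)} (f : A ⟶ B) (g : D.grp.obj A) :
    D.cgMap f (SemidirectProduct.inl g) = SemidirectProduct.inl (D.grp.map f g) := by
  ext <;> simp [cgMap]

/-- The subgroup `Ĝ^I(A)` of points fixed by inertia. -/
def invSubgroup (A : CommAlgCat.{u} (BaseRing F)) : Subgroup (D.grp.obj A) where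
  carrier := {g | ∀ i ∈ inertia F, D.act A (1, TameChoice.restr Ft i) g = g}
  one_mem' i _ := map_one _
  mul_mem' ha hb i hi := by rw [map_mul, ha i hi, hb i hi]
  inv_mem' ha i hi := by rw [map_inv, ha i hi]

theorem map_mem_invSubgroup {A B : CommAlgCat.{u} (BaseRing F)} (f : A ⟶ B) {g : D.grp.obj A}
    (hg : g ∈ D.invSubgroup A) : D.grp.map f g ∈ D.invSubgroup B := by
  intro i hi
  have h := D.natural f (1, TameChoice.restr Ft i) g
  rw [hg i hi] at h
  simpa using h.symm

/-- The group scheme `Ĝ^I` of inertia invariants. -/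
def inv : CommAlgCat.{u} (BaseRing F) ⥤ GrpCat.{u} where
  obj A := GrpCat.of (D.invSubgroup A)
  map {A B} f := GrpCat.ofHom
    { toFun := fun g => ⟨D.grp.map f g.1, D.map_mem_invSubgroup f g.2⟩
      map_one' := Subtype.ext (map_one _)
      map_mul' := fun _ _ => Subtype.ext (map_mul _ _ _) }
  map_id A := by
    ext g
    simp
  map_comp f g := by
    ext x
    simp

/-- The inclusion `Ĝ^I ⟶ Ĝ`. -/
def incl : D.inv ⟶ D.grp where
  app A := GrpCat.ofHom (D.invSubgroup A).subtype
  naturality _ _ _ := rfl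

theorem act_mem_invSubgroup {A : CommAlgCat.{u} (BaseRing F)} (t : Aˣ) (γ : AbsGal F)
    {g : D.grp.obj A} (hg : g ∈ D.invSubgroup A) :
    D.act A (t, TameChoice.restr Ft γ) g ∈ D.invSubgroup A := by
  intro i hi
  have h1 := hg _ ((inferInstance : (inertia F).Normal).conj_mem i hi γ⁻¹)
  rw [← MulAut.mul_apply, ← map_mul]
  conv_rhs => rw [← h1, ← MulAut.mul_apply, ← map_mul]
  congr 2
  simp [mul_assoc]

variable (c : TameChoice F)

/-- The element `(q⁻¹, σ)` of `𝔾ₘ(A) × Gal(F̃/F)`. -/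
def frobElt (A : CommAlgCat.{u} (BaseRing F)) : Aˣ × (Ft ≃ₐ[F] Ft) :=
  ((Units.map (algebraMap (BaseRing F) A) (qUnit F))⁻¹, TameChoice.restr Ft c.σ)

theorem map_qUnit {A B : CommAlgCat.{u} (BaseRing F)} (f : A ⟶ B) :
    Units.map f.hom.toRingHom.toMonoidHom (Units.map (algebraMap (BaseRing F) A) (qUnit F)) =
      Units.map (algebraMap (BaseRing F) B) (qUnit F) :=
  Units.ext (f.hom.commutes _)

theorem torMap_frobElt {A B : CommAlgCat.{u} (BaseRing F)} (f : A ⟶ B) :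
    torMap f (frobElt c A : Aˣ × (Ft ≃ₐ[F] Ft)) = frobElt c B := by
  refine Prod.ext ?_ rfl
  change Units.map f.hom.toRingHom.toMonoidHom (_)⁻¹ = _
  rw [map_inv, map_qUnit]
  rfl

theorem torMap_chi {A B : CommAlgCat.{u} (BaseRing F)} (f : A ⟶ B) (γ : c.disc) :
    torMap f (c.chi Ft A γ) = c.chi Ft B γ := by
  refine Prod.ext ?_ rfl
  change Units.map f.hom.toRingHom.toMonoidHom
    (Units.map (algebraMap (BaseRing F) A) (qUnit F) ^ (-c.deg γ)) = _
  rw [map_zpow, map_qUnit]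
  rfl

theorem chi_eq (A : CommAlgCat.{u} (BaseRing F)) (γ : c.disc) :
    ∃ i ∈ inertia F, c.chi Ft A γ = frobElt c A ^ c.deg γ * (1, TameChoice.restr Ft i) := by
  refine ⟨c.σ ^ (-c.deg γ) * γ, ?_, ?_⟩
  · have h := (inferInstance : (inertia F).Normal).conj_mem _ (c.deg_spec γ) (c.σ ^ (-c.deg γ))
    convert h using 1
    group
  · refine Prod.ext ?_ ?_
    · simp [frobElt, TameChoice.chi]
    · simp [frobElt, TameChoice.chi]

/-- The space `Ĝ^I q⁻¹σ ⊆ ᶜG` with the conjugation action of `Ĝ^I`. -/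
def sphSpace : GSpace.{u} D.inv where
  obj A := {x : D.CG A // x.left ∈ D.invSubgroup A ∧ x.right = frobElt c A}
  map f x := ⟨D.cgMap f x.1, D.map_mem_invSubgroup f x.2.1, by
    have h := congrArg (torMap f) x.2.2
    rw [torMap_frobElt] at h
    exact h⟩
  map_id x := Subtype.ext (D.cgMap_id _)
  map_comp f g x := Subtype.ext (D.cgMap_comp f g _)
  smul {A} h x := ⟨SemidirectProduct.inl h.1 * x.1 * (SemidirectProduct.inl h.1)⁻¹, by
    have h1 := D.act_mem_invSubgroup (Units.map (algebraMap (BaseRing F) A) (qUnit F))⁻¹ c.σ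
      (inv_mem h.2)
    have h2 := mul_mem (mul_mem h.2 x.2.1) h1
    have h3 : D.act A x.1.right h.1⁻¹ = D.act A (frobElt c A) h.1⁻¹ := by rw [x.2.2]
    simp only [← map_inv, SemidirectProduct.mul_left, SemidirectProduct.left_inl,
      SemidirectProduct.mul_right, SemidirectProduct.right_inl, map_one, MulAut.one_apply, one_mul,
      h3]
    exact h2, by simp [x.2.2]⟩
  one_smul x := Subtype.ext (by
    change SemidirectProduct.inl 1 * x.1 * (SemidirectProduct.inl 1)⁻¹ = x.1
    simp)
  mul_smul g h x := Subtype.ext (by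
    change SemidirectProduct.inl (g.1 * h.1) * x.1 * (SemidirectProduct.inl (g.1 * h.1))⁻¹ =
      SemidirectProduct.inl g.1 * (SemidirectProduct.inl h.1 * x.1 *
        (SemidirectProduct.inl h.1)⁻¹) * (SemidirectProduct.inl g.1)⁻¹
    simp [mul_assoc])
  map_smul f g x := Subtype.ext (by
    change D.cgMap f (SemidirectProduct.inl g.1 * x.1 * (SemidirectProduct.inl g.1)⁻¹) =
      SemidirectProduct.inl (D.grp.map f g.1) * D.cgMap f x.1 *
        (SemidirectProduct.inl (D.grp.map f g.1))⁻¹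
    simp only [map_mul, map_inv, cgMap_inl])

/-- The space `Loc^□` of framed Langlands parameters: homomorphisms `ρ : Γ_{F,ι} ⟶ ᶜG(A)` with
`d ∘ ρ = χ` that are trivial on an open subgroup of the wild inertia group; `Ĝ` acts by
conjugation. This is the filtered union, over the finite extensions `L` of the maximal tame
extension, of the schemes of parameters that factor through the quotient by `Gal(F̄/L)`. -/
def locSpace : GSpace.{u} D.grp where
  obj A := {ρ : c.disc →* D.CG A // (∀ γ, (ρ γ).right = c.chi Ft A γ) ∧
    ∃ E : IntermediateField F (AlgebraicClosure F), FiniteDimensional F E ∧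
      ∀ γ : c.disc, (γ : AbsGal F) ∈ wildInertia F → (γ : AbsGal F) ∈ E.fixingSubgroup → ρ γ = 1}
  map f ρ := ⟨(D.cgMap f).comp ρ.1, fun γ => by
    rw [← torMap_chi c f, ← ρ.2.1]; rfl, by
      obtain ⟨E, hE, h⟩ := ρ.2.2
      exact ⟨E, hE, fun γ h1 h2 => by simp [h γ h1 h2]⟩⟩
  map_id ρ := Subtype.ext (by ext1 γ; exact D.cgMap_id _)
  map_comp f g ρ := Subtype.ext (by ext1 γ; exact D.cgMap_comp f g _)
  smul g ρ := ⟨(MulAut.conj (SemidirectProduct.inl g)).toMonoidHom.comp ρ.1,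
    fun γ => by simp [ρ.2.1], by
      obtain ⟨E, hE, h⟩ := ρ.2.2
      exact ⟨E, hE, fun γ h1 h2 => by simp [h γ h1 h2]⟩⟩
  one_smul ρ := Subtype.ext (by ext1 γ; simp)
  mul_smul g h ρ := Subtype.ext (by ext1 γ; simp [mul_assoc])
  map_smul f g ρ := Subtype.ext (by
    ext1 γ
    simp [cgMap_inl])

theorem locSpace_isSheaf : (D.locSpace c).toPsh.IsSheaf := by
  intro A B f hf ρ hρ
  have hinj : ∀ {g h : D.grp.obj A}, D.grp.map f g = D.grp.map f h → g = h := by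
    intro g h e
    exact (D.isSheaf f hf (D.grp.map f h) (fun u v huv => by
      change D.grp.map u (D.grp.map f h) = D.grp.map v (D.grp.map f h)
      rw [← ConcreteCategory.comp_apply, ← ConcreteCategory.comp_apply, ← Functor.map_comp,
        ← Functor.map_comp, huv])).unique e rfl
  have hex : ∀ γ, ∃ g : D.grp.obj A, D.grp.map f g = (ρ.1 γ).left := fun γ =>
    (D.isSheaf f hf (ρ.1 γ).left fun u v huv =>
      congrArg (fun t : (D.locSpace c).obj _ => (t.1 γ).left) (hρ u v huv)).exists
  choose g hg using hex
  have hval : ∀ γ, D.cgMap f ⟨g γ, c.chi Ft A γ⟩ = ρ.1 γ := by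
    intro γ
    refine SemidirectProduct.ext (hg γ) ?_
    rw [ρ.2.1 γ]
    exact torMap_chi c f γ
  have hcg : ∀ {x y : D.CG A}, x.right = y.right → D.cgMap f x = D.cgMap f y → x = y := by
    intro x y h1 h2
    exact SemidirectProduct.ext (hinj (congrArg SemidirectProduct.left h2)) h1
  refine ⟨⟨{ toFun := fun γ => ⟨g γ, c.chi Ft A γ⟩, map_one' := ?_, map_mul' := ?_ },
    fun γ => rfl, ?_⟩, ?_, ?_⟩
  · apply hcg
    · simp
    · rw [hval, map_one, map_one]
  · intro γ δ
    apply hcg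
    · simp
    · rw [hval, map_mul, map_mul, hval, hval]
  · obtain ⟨E, hE, h⟩ := ρ.2.2
    refine ⟨E, hE, fun γ h1 h2 => ?_⟩
    have h3 := h γ h1 h2
    apply hcg
    · have h4 := ρ.2.1 γ
      rw [h3] at h4
      refine Prod.ext ?_ (congrArg Prod.snd h4).symm
      change Units.map (algebraMap (BaseRing F) A : BaseRing F →* A) (qUnit F) ^ (-c.deg γ) = 1
      rw [c.deg_inertia (TameChoice.wildInertia_le_inertia h1), neg_zero, zpow_zero]
    · exact (hval γ).trans (h3.trans (map_one _).symm)
  · refine Subtype.ext ?_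
    ext1 γ
    exact hval γ
  · intro ρ' h
    refine Subtype.ext ?_
    ext1 γ
    apply hcg
    · exact ρ'.2.1 γ
    · have h1 := congrArg (fun t : (D.locSpace c).obj _ => t.1 γ) h
      exact h1.trans (hval γ).symm

theorem act_mem_invSubgroup' {A : CommAlgCat.{u} (BaseRing F)} (t : Aˣ × (Ft ≃ₐ[F] Ft))
    {g : D.grp.obj A} (hg : g ∈ D.invSubgroup A) : D.act A t g ∈ D.invSubgroup A := by
  obtain ⟨t, δ⟩ := t
  obtain ⟨γ, rfl⟩ : ∃ γ, TameChoice.restr Ft γ = δ :=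
    AlgEquiv.restrictNormalHom_surjective (AlgebraicClosure F) δ
  exact D.act_mem_invSubgroup t γ hg

/-- The subgroup of the points of the C-group whose component in `Ĝ` is fixed by inertia. -/
def cgInv (A : CommAlgCat.{u} (BaseRing F)) : Subgroup (D.CG A) where
  carrier := {y | y.left ∈ D.invSubgroup A}
  one_mem' := one_mem (D.invSubgroup A)
  mul_mem' hx hy := mul_mem (S := Subgroup (D.grp.obj A)) hx (D.act_mem_invSubgroup' _ hy)
  inv_mem' {x} hx := D.act_mem_invSubgroup' x.right⁻¹ (inv_mem hx)

theorem zpow_left_mem {A : CommAlgCat.{u} (BaseRing F)} (x : (D.sphSpace c).obj A) (n : ℤ) :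
    (x.1 ^ n).left ∈ D.invSubgroup A :=
  have h : x.1 ∈ D.cgInv A := x.2.1
  have h2 : x.1 ^ n ∈ D.cgInv A := zpow_mem h n
  h2

theorem zpow_right {A : CommAlgCat.{u} (BaseRing F)} (x : (D.sphSpace c).obj A) (n : ℤ) :
    (x.1 ^ n).right = frobElt c A ^ n :=
  (map_zpow (SemidirectProduct.rightHom (φ := D.act A)) x.1 n).trans
    (congrArg (fun t => t ^ n) x.2.2)

/-- On `Ĝ^I`, the element `χ(γ)` acts as the power of `(q⁻¹, σ)` given by the degree of `γ`. -/
theorem act_chi {A : CommAlgCat.{u} (BaseRing F)} (γ : c.disc) {g : D.grp.obj A}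
    (hg : g ∈ D.invSubgroup A) :
    D.act A (c.chi Ft A γ) g = D.act A (frobElt c A ^ c.deg γ) g := by
  obtain ⟨i, hi, h⟩ := chi_eq (Ft := Ft) c A γ
  rw [h, map_mul, MulAut.mul_apply, hg i hi]

/-- The parameter attached to a point `x = g q⁻¹σ` of `Ĝ^I q⁻¹σ`: it is trivial on inertia and
sends `σ` to `x`. -/
def sphParam {A : CommAlgCat.{u} (BaseRing F)} (x : (D.sphSpace c).obj A) : c.disc →* D.CG A where
  toFun γ := ⟨(x.1 ^ c.deg γ).left, c.chi Ft A γ⟩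
  map_one' := by
    rw [c.deg_one]
    ext <;> simp
  map_mul' γ δ := by
    refine SemidirectProduct.ext ?_ (map_mul _ _ _)
    simp only [SemidirectProduct.mul_left]
    rw [c.deg_mul, zpow_add, SemidirectProduct.mul_left, D.zpow_right,
      D.act_chi c γ (D.zpow_left_mem c x _)]

theorem sphParam_inertia {A : CommAlgCat.{u} (BaseRing F)} (x : (D.sphSpace c).obj A) (γ : c.disc)
    (h : (γ : AbsGal F) ∈ inertia F) :
    D.sphParam c x γ = SemidirectProduct.inr (1, TameChoice.restr Ft γ) := by
  have h0 := c.deg_inertia h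
  refine SemidirectProduct.ext ?_ ?_
  · change (x.1 ^ c.deg γ).left = 1
    rw [h0]
    simp
  · simp [sphParam, TameChoice.chi, h0]

theorem sphParam_σ {A : CommAlgCat.{u} (BaseRing F)} (x : (D.sphSpace c).obj A) :
    D.sphParam c x ⟨c.σ, c.σ_mem⟩ = x.1 := by
  refine SemidirectProduct.ext ?_ ?_
  · change (x.1 ^ c.deg _).left = _
    rw [c.deg_σ, zpow_one]
  · rw [x.2.2]
    simp [sphParam, TameChoice.chi, c.deg_σ, frobElt]

/-- The map `Ĝ^I q⁻¹σ ⟶ Loc^□`. -/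
def sphToLoc : GSpace.MapAlong D.incl (D.sphSpace c) (D.locSpace c) where
  app x := ⟨D.sphParam c x, fun γ => rfl, Ft, inferInstance, fun γ h1 h2 => by
    rw [D.sphParam_inertia c x γ (TameChoice.wildInertia_le_inertia h1)]
    have h3 : TameChoice.restr Ft (γ : AbsGal F) = 1 := by
      have := IntermediateField.restrictNormalHom_ker Ft
      rw [← this] at h2
      exact h2
    rw [h3]
    exact map_one _⟩
  natural {A B} f x := Subtype.ext (by
    ext1 γ
    refine SemidirectProduct.ext ?_ (torMap_chi c f γ).symm
    change ((D.cgMap f x.1) ^ c.deg γ).left = (D.cgMap f ⟨(x.1 ^ c.deg γ).left, _⟩).left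
    rw [← map_zpow]
    rfl)
  equivariant {A} h x := Subtype.ext (by
    ext1 γ
    have hh : (SemidirectProduct.inl h.1 * x.1 * (SemidirectProduct.inl h.1)⁻¹) ^ c.deg γ =
        SemidirectProduct.inl h.1 * x.1 ^ c.deg γ * (SemidirectProduct.inl h.1)⁻¹ :=
      conj_zpow
    refine SemidirectProduct.ext ?_ ?_
    · change ((SemidirectProduct.inl h.1 * x.1 * (SemidirectProduct.inl h.1)⁻¹) ^ c.deg γ).left =
        (SemidirectProduct.inl h.1 * (⟨(x.1 ^ c.deg γ).left, c.chi Ft A γ⟩ : D.CG A) *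
          (SemidirectProduct.inl h.1)⁻¹).left
      rw [hh]
      have h1 := D.zpow_right c x (c.deg γ)
      have h2 := D.act_chi c γ (inv_mem h.2)
      simp only [← map_inv, SemidirectProduct.mul_left, SemidirectProduct.left_inl,
        SemidirectProduct.mul_right, SemidirectProduct.right_inl, map_one, MulAut.one_apply,
        one_mul, h1]
      rw [h2]
    · change c.chi Ft A γ = (SemidirectProduct.inl h.1 *
        (⟨(x.1 ^ c.deg γ).left, c.chi Ft A γ⟩ : D.CG A) * (SemidirectProduct.inl h.1)⁻¹).right
      simp)

/-- The stack `Loc = Loc^□ / Ĝ` of Langlands parameters. -/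
abbrev Loc : Type _ := QuotStack (D.locSpace c)

/-- The stack `Loc^sph = Ĝ^I q⁻¹σ / Ĝ^I` of spherical Langlands parameters. -/
abbrev LocSph : Type _ := QuotStack (D.sphSpace c)

/-- The morphism of stacks `Φ : Loc^sph ⟶ Loc`. -/
def Φ : D.LocSph c ⥤ D.Loc c :=
  QuotStack.mapAlong D.incl D.isSheaf (D.sphToLoc c) (D.locSpace_isSheaf c)

/-- Restriction of modules along `Φ : Loc^sph ⟶ Loc`. -/
def pullbackΦ : QuotStack.Mod (D.locSpace c) ⥤ QuotStack.Mod (D.sphSpace c) :=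
  QuotStack.pullbackAlong D.incl D.isSheaf (D.sphToLoc c) (D.locSpace_isSheaf c)

/-- The functor sending a representation `V` of `Ĝ` to the vector bundle on `Loc^sph` defined by
the restriction of `V` to `Ĝ^I`. -/
def sphBundle : FinRep D.grp ⥤ QuotStack.Mod (D.sphSpace c) :=
  FinRep.res D.incl ⋙ FinRep.tilde (D.sphSpace c)

/-- The functor sending a representation `V` of `Ĝ` to the restriction along `Φ : Loc^sph ⟶ Loc` of
the vector bundle `Ṽ` on `Loc`. -/
def locBundle : FinRep D.grp ⥤ QuotStack.Mod (D.sphSpace c) :=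
  FinRep.tilde (D.locSpace c) ⋙ D.pullbackΦ c

/-- An isomorphism is canonical if, at every object `(P, φ)` of `Loc^sph`, it sends a section
`[p, s(p)]` of `P ×^{Ĝ^I} V` to the section `[[p, 1], s(p)]` of `(P ×^{Ĝ^I} Ĝ) ×^Ĝ V`. -/
def IsCanonical (θ : D.sphBundle c ≅ D.locBundle c) : Prop :=
  ∀ (V : FinRep D.grp) (x : D.LocSph c)
    (s : ((FinRep.res D.incl).obj V).Sections x.torsor)
    {B : CommAlgCat.{u} (BaseRing F)} {b : x.ring ⟶ B} (p : x.torsor.pt b),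
    FinRep.Sections.val (V := V) (P := x.torsor.induce D.incl D.isSheaf)
      ((θ.hom.app V).app (Opposite.op x) s) (x.torsor.toInduce D.incl D.isSheaf p) = s.val p

end CGroupDatum

end Parameters
end LanglandsParameters
end

/-! A section of `P ×^H V` is an equivariant function on the torsor `P`, so everything about `Ṽ`
depends only on the torsor of an object and not on its map to the space. Two general facts about
torsors therefore suffice, and neither uses anything specific to Langlands parameters.

For the canonical isomorphism, let `P` be an `H`-torsor and `i : H ⟶ G`. The map `p ↦ [p, 1]` is
equivariant along `i`, and fppf locally every point of `P ×^H G` has the form `[p, 1] g`. An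
equivariant function on `P ×^H G` is thus determined by its values at the points `[p, 1]`.
Conversely, the rule `[p, 1] g ↦ g⁻¹ s(p)` is well defined and descends, because `A ↦ A ⊗ V` is an
fppf sheaf. Hence restriction along `p ↦ [p, 1]` is bijective (`restrict_injective`,
`restrict_surjective`), and its inverse `extend` is the isomorphism sought. Naturality in the
object, naturality in `V`, and uniqueness all follow from injectivity of restriction
(`extend_unique`).

For the vector bundle property, a point of `P` over the base identifies the sections with `A ⊗ V`,
which is finite projective and compatible with every base change (`pullIsBaseChange_of_point`). In
general a point `p` exists over some fppf cover `A ⟶ B`, and `s ↦ s(p)` identifies the sections with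
the kernel of the difference of two maps `B ⊗ V ⟶ (B ⊗[A] B) ⊗ V`. Kernels commute with flat base
change (`pullIsBaseChange_of_flat`). Applied to the cover itself, this yields finiteness and
projectivity by faithfully flat descent (`finite_projective`). Arbitrary base change along `A ⟶ A'`
is then checked over a cover of `A'` on which a point of `P` exists (`pullIsBaseChange`). -/

noncomputable section

namespace LanglandsParameters

/-! ### Commutative algebra: faithfully flat descent and flat base change of modules. -/

section Descent

variable {R S T : Type*} [CommRing R] [CommRing S] [CommRing T] [Algebra R S]

/-- Finite projective modules descend along faithfully flat ring maps. -/
theorem finite_projective_of_isBaseChange [Module.FaithfullyFlat R S] {M N : Type*}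
    [AddCommGroup M] [Module R M] [AddCommGroup N] [Module R N] [Module S N] [IsScalarTower R S N]
    [Module.Finite S N] [Module.Projective S N] {f : M →ₗ[R] N} (hf : IsBaseChange S f) :
    Module.Finite R M ∧ Module.Projective R M := by
  have h1 : Module.Finite S (S ⊗[R] M) := Module.Finite.equiv hf.equiv.symm
  have h2 : Module.Projective S (S ⊗[R] M) := Module.Projective.of_equiv hf.equiv.symm
  have h3 : Module.Finite R M := Module.Finite.of_finite_tensorProduct_of_faithfullyFlat S
  have h4 : Module.Flat R M := (Module.Flat.iff_flat_tensorProduct R M S).mp inferInstance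
  have h5 : Module.FinitePresentation S (S ⊗[R] M) := Module.finitePresentation_of_projective _ _
  -- Finite presentation is descended through the kernel of a surjection `l` from a finite free
  -- module. Flatness of `S` identifies `S ⊗ ker l` with the kernel of `S ⊗ l`. This kernel is
  -- finitely generated because `S ⊗ M` is finitely presented, and finite generation descends.
  -- Flatness of `M` then upgrades finite presentation to projectivity.
  obtain ⟨n, l, hl⟩ := Module.Finite.exists_fin' R M
  have h6 : Function.Surjective (AlgebraTensorModule.lTensor S S l) :=
    LinearMap.lTensor_surjective S hl
  have h7 : Module.Finite S (AlgebraTensorModule.lTensor S S l).ker :=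
    Module.Finite.iff_fg.mpr (Module.FinitePresentation.fg_ker _ h6)
  have h8 : Module.Finite S (S ⊗[R] l.ker) :=
    Module.Finite.equiv (LinearMap.tensorKerEquiv S S l).symm
  have h9 : Module.Finite R l.ker := Module.Finite.of_finite_tensorProduct_of_faithfullyFlat S
  have h10 : Module.FinitePresentation R M :=
    Module.finitePresentation_of_surjective l hl (Module.Finite.iff_fg.mp h9)
  exact ⟨h3, Module.Flat.projective_of_finitePresentation⟩

/-- Being a base change can be checked after a further faithfully flat base change. -/
theorem isBaseChange_of_comp_faithfullyFlat [Algebra R T] [Algebra S T] [IsScalarTower R S T]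
    [Module.FaithfullyFlat S T] {M N K : Type*} [AddCommGroup M] [Module R M]
    [AddCommGroup N] [Module R N] [Module S N] [IsScalarTower R S N]
    [AddCommGroup K] [Module R K] [Module S K] [Module T K] [IsScalarTower R T K]
    [IsScalarTower S T K] [IsScalarTower R S K] {f : M →ₗ[R] N} {g : N →ₗ[S] K}
    (hg : IsBaseChange T g) (h : IsBaseChange T ((g.restrictScalars R).comp f)) :
    IsBaseChange S f := by
  let φ : S ⊗[R] M →ₗ[S] N := (TensorProduct.isBaseChange R M S).lift f
  have hφ : ∀ m, φ (1 ⊗ₜ m) = f m := (TensorProduct.isBaseChange R M S).lift_eq f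
  have hφ' : ∀ s m, φ (s ⊗ₜ m) = s • f m := fun s m => by
    rw [← hφ, ← map_smul, smul_tmul', smul_eq_mul, mul_one]
  -- After tensoring with `T` over `S`, the map `φ` becomes the comparison map `T ⊗[R] M ⟶ K` of the
  -- composite, which is bijective by `h`. Faithful flatness of `T` over `S` reflects this
  -- bijectivity back to `φ`.
  have h1 : ∀ x, hg.equiv (AlgebraTensorModule.lTensor T T φ x) =
      h.equiv (AlgebraTensorModule.cancelBaseChange R S T T M x) := by
    intro x
    induction x with
    | zero => simp
    | add x y hx hy => rw [map_add, map_add, map_add, map_add, hx, hy]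
    | tmul t y =>
      induction y with
      | zero => simp
      | add x y hx hy => simp only [tmul_add, map_add, hx, hy]
      | tmul s m =>
        simp [hφ', IsBaseChange.equiv_tmul]
        rw [smul_tmul', IsBaseChange.equiv_tmul, smul_assoc]
  have h2 : Function.Bijective φ := by
    rw [← Module.FaithfullyFlat.lTensor_bijective_iff_bijective S T]
    have h3 : Function.Bijective (hg.equiv ∘ AlgebraTensorModule.lTensor T T φ) := by
      have : hg.equiv ∘ AlgebraTensorModule.lTensor T T φ =
        h.equiv ∘ AlgebraTensorModule.cancelBaseChange R S T T M := funext h1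
      rw [this]
      exact h.equiv.bijective.comp (LinearEquiv.bijective _)
    exact (Function.Bijective.of_comp_iff' hg.equiv.bijective _).mp h3
  exact .of_equiv (LinearEquiv.ofBijective φ h2) hφ

/-- Kernels commute with flat base change. -/
theorem isBaseChange_of_exact [Module.Flat R S] {M N L M' N' L' : Type*}
    [AddCommGroup M] [Module R M] [AddCommGroup N] [Module R N] [AddCommGroup L] [Module R L]
    [AddCommGroup M'] [Module R M'] [Module S M'] [IsScalarTower R S M']
    [AddCommGroup N'] [Module R N'] [Module S N'] [IsScalarTower R S N']
    [AddCommGroup L'] [Module R L'] [Module S L'] [IsScalarTower R S L']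
    {α : M →ₗ[R] N} {β : N →ₗ[R] L} {α' : M' →ₗ[S] N'} {β' : N' →ₗ[S] L'}
    (hα : Function.Injective α) (hαβ : Function.Exact α β)
    (hα' : Function.Injective α') (hαβ' : Function.Exact α' β')
    {f : M →ₗ[R] M'} {g : N →ₗ[R] N'} {h : L →ₗ[R] L'}
    (hg : IsBaseChange S g) (hh : IsBaseChange S h)
    (hfg : ∀ m, α' (f m) = g (α m)) (hgh : ∀ n, β' (g n) = h (β n)) :
    IsBaseChange S f := by
  let φ : S ⊗[R] M →ₗ[S] M' := (TensorProduct.isBaseChange R M S).lift f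
  have hφ : ∀ m, φ (1 ⊗ₜ m) = f m := (TensorProduct.isBaseChange R M S).lift_eq f
  have h1 : ∀ x, α' (φ x) = hg.equiv (α.lTensor S x) := by
    intro x
    induction x with
    | zero => simp
    | add x y hx hy => simp only [map_add, hx, hy]
    | tmul s m =>
      have : s ⊗ₜ[R] m = s • (1 ⊗ₜ m) := by rw [smul_tmul', smul_eq_mul, mul_one]
      rw [LinearMap.lTensor_tmul, IsBaseChange.equiv_tmul, this, map_smul, map_smul, hφ, hfg]
  have h2 : ∀ x, β' (hg.equiv x) = hh.equiv (β.lTensor S x) := by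
    intro x
    induction x with
    | zero => simp
    | add x y hx hy => simp only [map_add, hx, hy]
    | tmul s m =>
      rw [LinearMap.lTensor_tmul, IsBaseChange.equiv_tmul, IsBaseChange.equiv_tmul, map_smul, hgh]
  -- By `h1` and `h2` the comparison maps form a commutative ladder between `S ⊗ M → S ⊗ N → S ⊗ L`
  -- and `M' → N' → L'`. The upper row is still exact, and its first map still injective, by
  -- flatness. The two right-hand verticals are isomorphisms, so the left one is too.
  have h3 : Function.Bijective φ := by
    constructor
    · have h4 : Function.Injective (α' ∘ φ) := by
        have : α' ∘ φ = hg.equiv ∘ α.lTensor S := funext h1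
        rw [this]
        exact hg.equiv.injective.comp (Module.Flat.lTensor_preserves_injective_linearMap α hα)
      exact h4.of_comp
    · intro m
      obtain ⟨n, hn⟩ := hg.equiv.surjective (α' m)
      have h4 : β.lTensor S n = 0 := by
        apply hh.equiv.injective
        rw [← h2, hn, map_zero]
        exact (hαβ' _).mpr ⟨m, rfl⟩
      obtain ⟨x, rfl⟩ := (Module.Flat.lTensor_exact S hαβ n).mp h4
      exact ⟨x, hα' ((h1 x).trans hn)⟩
  exact .of_equiv (LinearEquiv.ofBijective φ h3) hφ

end Descent

/-! ### Sections of associated bundles are determined, and constructed, fppf locally. -/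

section Sections

variable {k : Type} [CommRing k]

theorem bc_id (V : Type u) [AddCommGroup V] [Module k V] {A : CommAlgCat.{u} k} (x : A ⊗[k] V) :
    bc V (𝟙 A) x = x :=
  LinearMap.rTensor_id_apply V A x

theorem bc_comp (V : Type u) [AddCommGroup V] [Module k V] {A B C : CommAlgCat.{u} k} (f : A ⟶ B)
    (g : B ⟶ C) (x : A ⊗[k] V) : bc V (f ≫ g) x = bc V g (bc V f x) :=
  LinearMap.rTensor_comp_apply V g.hom.toLinearMap f.hom.toLinearMap x

/-- The presheaf of sets `A ↦ A ⊗ V`. -/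
@[simps]
def modPsh (V : Type u) [AddCommGroup V] [Module k V] : Psh.{u, u} k where
  obj A := A ⊗[k] V
  map f := bc V f
  map_id := bc_id V
  map_comp := bc_comp V

/-- Faithfully flat descent for elements of a flat module. -/
theorem modPsh_isSheaf (V : Type u) [AddCommGroup V] [Module k V] [Module.Flat k V] :
    (modPsh (k := k) V).IsSheaf := by
  intro A B f hf x hx
  let _ := f.hom.toRingHom.toAlgebra
  have : IsScalarTower k A B := .of_algebraMap_eq fun x => (f.hom.commutes x).symm
  have h1 : Module.FaithfullyFlat A B := hf.1
  have hinj : Function.Injective (bc V f) :=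
    Module.Flat.rTensor_preserves_injective_linearMap _ (RingHom.FaithfullyFlat.injective hf.1)
  let l : B ⟶ CommAlgCat.of k (B ⊗[A] B) := CommAlgCat.ofHom
    ((Algebra.TensorProduct.includeLeft : B →ₐ[A] B ⊗[A] B).restrictScalars k)
  let r : B ⟶ CommAlgCat.of k (B ⊗[A] B) := CommAlgCat.ofHom
    ((Algebra.TensorProduct.includeRight : B →ₐ[A] B ⊗[A] B).restrictScalars k)
  have hlr : f ≫ l = f ≫ r := by
    ext a
    have h3 := (Algebra.TensorProduct.includeRight : B →ₐ[A] B ⊗[A] B).commutes a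
    have h4 := (Algebra.TensorProduct.includeLeft : B →ₐ[A] B ⊗[A] B).commutes a
    exact h4.trans h3.symm
  -- This is the exactness of `A → B → B ⊗[A] B` in the Amitsur complex. Since `V` is flat over `k`,
  -- the sequence stays exact after tensoring with `V`, and the gluing hypothesis for the pair `l`,
  -- `r` says that `x` lies in the kernel.
  have hex : Function.Exact f.hom.toLinearMap (l.hom.toLinearMap - r.hom.toLinearMap) := by
    intro b
    have h2 := Algebra.IsEffective.of_faithfullyFlat A B b
    rw [Algebra.TensorProduct.includeLeftSubRight_apply] at h2
    exact h2
  have hker : (l.hom.toLinearMap - r.hom.toLinearMap).rTensor V x = 0 := by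
    rw [LinearMap.rTensor_sub]
    exact sub_eq_zero.mpr (hx l r hlr)
  obtain ⟨y, hy⟩ := (Module.Flat.rTensor_exact V hex x).mp hker
  exact ⟨y, hy, fun z hz => hinj (hz.trans hy.symm)⟩

namespace FinRep

variable {G : CommAlgCat.{u} k ⥤ GrpCat.{u}} {A : CommAlgCat.{u} k}

theorem ρ_mul_apply (V : FinRep G) {B : CommAlgCat.{u} k} (g h : G.obj B) (x : B ⊗[k] V.V) :
    V.ρ B (g * h) x = V.ρ B g (V.ρ B h x) := by
  rw [map_mul, Module.End.mul_apply]

theorem ρ_one_apply (V : FinRep G) {B : CommAlgCat.{u} k} (x : B ⊗[k] V.V) :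
    V.ρ B 1 x = x := by
  rw [map_one, Module.End.one_apply]

/-- Two sections that agree fppf locally are equal. -/
theorem Sections.ext_of_locally {V : FinRep G} {P : Torsor G A} {s t : V.Sections P}
    (h : ∀ {B : CommAlgCat.{u} k} {b : A ⟶ B} (p : P.pt b), ∃ (C : CommAlgCat.{u} k) (f : B ⟶ C),
      IsFppf f ∧ s.val (P.map f rfl p) = t.val (P.map f rfl p)) : s = t := by
  refine Sections.ext fun {B b} p => ?_
  obtain ⟨C, f, hf, hst⟩ := h p
  rw [s.val_map, t.val_map] at hst
  exact (modPsh_isSheaf V.V f hf (bc V.V f (t.val p)) fun u v huv => by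
    change bc V.V u (bc V.V f (t.val p)) = bc V.V v (bc V.V f (t.val p))
    rw [← bc_comp, ← bc_comp, huv]).unique hst rfl

/-- Construction of a section from a relation between points and values that is functional,
equivariant and fppf locally total. -/
theorem Sections.exists_of_rel (V : FinRep G) (P : Torsor G A)
    (R : ∀ {B : CommAlgCat.{u} k} {b : A ⟶ B}, P.pt b → B ⊗[k] V.V → Prop)
    (hmap : ∀ {B C : CommAlgCat.{u} k} {b : A ⟶ B} {c : A ⟶ C} (f : B ⟶ C) (hf : b ≫ f = c)
      (p : P.pt b) (x : B ⊗[k] V.V), R p x → R (P.map f hf p) (bc V.V f x))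
    (hact : ∀ {B : CommAlgCat.{u} k} {b : A ⟶ B} (p : P.pt b) (g : G.obj B) (x : B ⊗[k] V.V),
      R p x → R (P.act p g) (V.ρ B g⁻¹ x))
    (huniq : ∀ {B : CommAlgCat.{u} k} {b : A ⟶ B} (p : P.pt b) (x y : B ⊗[k] V.V),
      R p x → R p y → x = y)
    (hex : ∀ {B : CommAlgCat.{u} k} {b : A ⟶ B} (p : P.pt b), ∃ (C : CommAlgCat.{u} k) (f : B ⟶ C)
      (x : C ⊗[k] V.V), IsFppf f ∧ R (P.map f rfl p) x) :
    ∃ s : V.Sections P, ∀ {B : CommAlgCat.{u} k} {b : A ⟶ B} (p : P.pt b) (x : B ⊗[k] V.V),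
      R p x → s.val p = x := by
  -- The value at `p` is characterised by all base changes at which `R` prescribes a value, not by
  -- one chosen cover. Compatibility with base change and with the action can then be deduced from
  -- uniqueness alone.
  have hval : ∀ {B : CommAlgCat.{u} k} {b : A ⟶ B} (p : P.pt b), ∃! y : B ⊗[k] V.V,
      ∀ {C : CommAlgCat.{u} k} {c : A ⟶ C} (f : B ⟶ C) (hf : b ≫ f = c) (x : C ⊗[k] V.V),
        R (P.map f hf p) x → bc V.V f y = x := by
    intro B b p
    obtain ⟨y, hy, hy'⟩ := Psh.IsSheaf.descend (modPsh_isSheaf (k := k) V.V) (B := B)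
      (fun {C} f x => R (P.map f rfl p) x)
      (by
        intro C D f g x hx
        rw [P.map_comp f g rfl (Category.assoc _ _ _) rfl]
        exact hmap g _ _ _ hx)
      (fun f x y hx hy => huniq _ x y hx hy)
      (hex p)
    refine ⟨y, fun {C c} f hf x hx => ?_, fun z hz => hy' z fun f x hx => hz f rfl x hx⟩
    subst hf
    exact hy f x hx
  refine ⟨⟨fun {B b} p => (hval p).choose, ?_, ?_⟩, ?_⟩
  · intro B C b c f hf p
    refine ((hval (P.map f hf p)).choose_spec.2 _ ?_).symm
    intro D d g hg x hx
    rw [← P.map_comp f g hf hg (by rw [← hg, ← hf, Category.assoc])] at hx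
    beta_reduce
    rw [← bc_comp]
    exact (hval p).choose_spec.1 (f ≫ g) _ x hx
  · intro B b p g
    refine ((hval (P.act p g)).choose_spec.2 _ ?_).symm
    intro D d f hf x hx
    -- Acting by the inverse of `g` turns a prescribed value at the image of `p g` into one at the
    -- image of `p`, where the defining property of the value at `p` applies.
    have h1 := hact _ (G.map f g)⁻¹ _ hx
    rw [P.map_act, ← P.act_mul, mul_inv_cancel, P.act_one, inv_inv] at h1
    have h2 := (hval p).choose_spec.1 f hf _ h1
    beta_reduce
    rw [V.natural, h2, ← ρ_mul_apply, ← map_mul, inv_mul_cancel, map_one, ρ_one_apply]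
  · intro B b p x hx
    have h1 := (hval p).choose_spec.1 (𝟙 B) (Category.comp_id _) x (by rwa [P.map_id])
    rw [bc_id] at h1
    exact h1

end FinRep
end Sections

/-! ### Sections on `P` compared with sections on the induced torsor `P ×^H G`. -/

section InducedSections

variable {k : Type} [CommRing k] {G H : CommAlgCat.{u} k ⥤ GrpCat.{u}} {A : CommAlgCat.{u} k}

namespace Torsor

variable (i : H ⟶ G) (hG : (grpPsh G).IsSheaf) (P : Torsor H A)

theorem toInduce_map {B C : CommAlgCat.{u} k} {b : A ⟶ B} {c : A ⟶ C} (f : B ⟶ C)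
    (hf : b ≫ f = c) (p : P.pt b) :
    P.toInduce i hG (P.map f hf p) = (P.induce i hG).map f hf (P.toInduce i hG p) := by
  refine IndPt.ext' fun {D d} g hd p' => ?_
  change (i.app _ (P.diff (P.map g hd (P.map f hf p)) p'))⁻¹ =
    (i.app _ (P.diff (P.map (f ≫ g) _ p) p'))⁻¹
  rw [P.map_comp f g hf hd]

/-- In the notation of contracted products this is `[p h, 1] = [p, i(h)]`. It reduces to `p' = p h
((p h)⁻¹ p')`, where the quotient of two points denotes their difference in `H`. -/
theorem toInduce_act {B : CommAlgCat.{u} k} {b : A ⟶ B} (p : P.pt b) (h : H.obj B) :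
    P.toInduce i hG (P.act p h) = (P.induce i hG).act (P.toInduce i hG p) (i.app B h) := by
  refine IndPt.ext' fun {D d} g hd p' => ?_
  change (i.app _ (P.diff (P.map g hd (P.act p h)) p'))⁻¹ =
    (i.app _ (P.diff (P.map g hd p) p'))⁻¹ * G.map g (i.app B h)
  have h1 : P.diff (P.map g hd p) p' = H.map g h * P.diff (P.map g hd (P.act p h)) p' := by
    apply P.act_injective (P.map g hd p)
    rw [P.act_diff, P.act_mul, ← P.map_act, P.act_diff]
  rw [h1, map_mul, mul_inv_rev, ← NatTrans.naturality_apply, inv_mul_cancel_right]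

/-- Wherever `P` has a point, that point trivializes the induced torsor. This is the local form of
points on which both halves of the comparison of sections rest. -/
theorem exists_eq_act_toInduce {B : CommAlgCat.{u} k} {b : A ⟶ B} (t : (P.induce i hG).pt b)
    (p : P.pt b) : ∃ g : G.obj B, t = (P.induce i hG).act (P.toInduce i hG p) g :=
  ⟨_, ((P.induce i hG).act_diff (P.toInduce i hG p) t).symm⟩

theorem IsoOver.diff_equiv {A' : CommAlgCat.{u} k} {f : A ⟶ A'} {P' : Torsor H A'}
    {P : Torsor H A} (e : IsoOver f P' P) {B : CommAlgCat.{u} k} {b' : A' ⟶ B} {b : A ⟶ B}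
    (hb : f ≫ b' = b) (p q : P'.pt b') :
    P.diff (e.equiv hb p) (e.equiv hb q) = P'.diff p q := by
  apply P.act_injective (e.equiv hb p)
  rw [P.act_diff, ← e.equivariant, P'.act_diff]

variable {P}

/-- An isomorphism of torsors preserves differences of points, and `[p, 1]` is defined by
differences. This is what makes the comparison of sections natural in the object of the stack. -/
theorem IsoOver.induce_toInduce {A' : CommAlgCat.{u} k} {f : A ⟶ A'} {P' : Torsor H A'}
    (e : IsoOver f P' P) {B : CommAlgCat.{u} k} {b' : A' ⟶ B} {b : A ⟶ B} (hb : f ≫ b' = b)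
    (p : P'.pt b') :
    (e.induce i hG).equiv hb (P'.toInduce i hG p) = P.toInduce i hG (e.equiv hb p) := by
  refine IndPt.ext' fun {D d} g hd q => ?_
  have hd' : f ≫ b' ≫ g = d := by rw [← hd, ← hb, Category.assoc]
  change (i.app _ (P'.diff (P'.map g rfl p) ((e.equiv hd').symm q)))⁻¹ =
    (i.app _ (P.diff (P.map g hd (e.equiv hb p)) q))⁻¹
  rw [← e.diff_equiv hd', Equiv.apply_symm_apply, e.natural hb hd' g rfl hd]

end Torsor

namespace FinRep.Sections

variable (i : H ⟶ G) (hG : (grpPsh G).IsSheaf) (V : FinRep G) (P : Torsor H A)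

/-- Restriction of sections along `P ⟶ P ×^H G`. -/
def restrict : V.Sections (P.induce i hG) →ₗ[A] ((res i).obj V).Sections P where
  toFun t := ⟨fun {B b} p => t.val (P.toInduce i hG p),
    fun {B C b c} f hf p => by
      beta_reduce
      rw [P.toInduce_map, t.val_map]
      rfl,
    fun {B b} p h => by
      beta_reduce
      rw [P.toInduce_act, t.val_act, ← map_inv]
      rfl⟩
  map_add' s t := rfl
  map_smul' a s := rfl

variable {V P}

theorem val_restrict (t : V.Sections (P.induce i hG)) {B : CommAlgCat.{u} k} {b : A ⟶ B}
    (p : P.pt b) : (restrict i hG V P t).val p = t.val (P.toInduce i hG p) := rfl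

/-- Fppf locally a point of the induced torsor is `[p, 1] g`, where equivariance gives the value
`g⁻¹ s([p, 1])`. -/
theorem restrict_injective : Function.Injective (restrict i hG V P) := by
  intro s t hst
  refine ext_of_locally fun {B b} q => ?_
  obtain ⟨C, f, hf, ⟨p⟩⟩ := P.locally_nonempty b
  refine ⟨C, f, hf, ?_⟩
  obtain ⟨g, hg⟩ := P.exists_eq_act_toInduce i hG ((P.induce i hG).map f rfl q) p
  have h1 : s.val (P.toInduce i hG p) = t.val (P.toInduce i hG p) :=
    congrArg (fun r : ((res i).obj V).Sections P => r.val p) hst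
  rw [hg, s.val_act, t.val_act, h1]

/-- Equivariance forces the value `g⁻¹ s(p)` at `[p, 1] g`. If `[p, 1] g = [p', 1] g'` with `p' = p
h`, then `g = i(h) g'`, so equivariance of `s` under `H` makes the two prescriptions agree. The
value at points not of this form is obtained by descent. -/
theorem restrict_surjective : Function.Surjective (restrict i hG V P) := by
  intro s
  -- The restricted representation has the same underlying module as `V`. Viewing the values of `s`
  -- there lets all of `G` act on them.
  let val {B : CommAlgCat.{u} k} {b : A ⟶ B} (p : P.pt b) : B ⊗[k] V.V := s.val p
  have hval_map : ∀ {B C : CommAlgCat.{u} k} {b : A ⟶ B} {c : A ⟶ C} (f : B ⟶ C)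
      (hf : b ≫ f = c) (p : P.pt b), val (P.map f hf p) = bc V.V f (val p) := s.val_map
  have hval_act : ∀ {B : CommAlgCat.{u} k} {b : A ⟶ B} (p : P.pt b) (h : H.obj B),
      val (P.act p h) = V.ρ B (i.app B h)⁻¹ (val p) := by
    intro B b p h
    rw [← map_inv]
    exact s.val_act p h
  obtain ⟨t, ht⟩ := exists_of_rel V (P.induce i hG)
    (fun {B b} q x => ∃ (p : P.pt b) (g : G.obj B),
      q = (P.induce i hG).act (P.toInduce i hG p) g ∧ x = V.ρ B g⁻¹ (val p))
    (by
      rintro B C b c f hf _ _ ⟨p, g, rfl, rfl⟩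
      refine ⟨P.map f hf p, G.map f g, ?_, ?_⟩
      · rw [P.toInduce_map, (P.induce i hG).map_act]
      · rw [V.natural, hval_map, map_inv])
    (by
      rintro B b _ g _ ⟨p, g', rfl, rfl⟩
      refine ⟨p, g' * g, ?_, ?_⟩
      · rw [(P.induce i hG).act_mul]
      · rw [mul_inv_rev, ρ_mul_apply])
    (by
      rintro B b _ _ _ ⟨p, g, rfl, rfl⟩ ⟨p', g', h1, rfl⟩
      rw [← P.act_diff p p', P.toInduce_act, ← (P.induce i hG).act_mul] at h1
      rw [(P.induce i hG).act_injective _ h1]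
      conv_rhs => rw [← P.act_diff p p', hval_act, ← ρ_mul_apply, ← mul_inv_rev])
    (by
      intro B b q
      obtain ⟨C, f, hf, ⟨p⟩⟩ := P.locally_nonempty b
      obtain ⟨g, hg⟩ := P.exists_eq_act_toInduce i hG ((P.induce i hG).map f rfl q) p
      exact ⟨C, f, _, hf, p, g, hg, rfl⟩)
  refine ⟨t, ext fun {B b} p => ?_⟩
  rw [val_restrict]
  exact ht _ _ ⟨p, 1, ((P.induce i hG).act_one _).symm, by
    rw [inv_one, ρ_one_apply]⟩

variable (V P)

/-- The isomorphism `P ×^H V ≅ (P ×^H G) ×^G V`, `[p, v] ↦ [[p, 1], v]`, on sections. -/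
def extend : ((res i).obj V).Sections P ≃ₗ[A] V.Sections (P.induce i hG) :=
  (LinearEquiv.ofBijective (restrict i hG V P)
    ⟨restrict_injective i hG, restrict_surjective i hG⟩).symm

variable {V P}

theorem val_extend (s : ((res i).obj V).Sections P) {B : CommAlgCat.{u} k} {b : A ⟶ B}
    (p : P.pt b) : (extend i hG V P s).val (P.toInduce i hG p) = s.val p := by
  rw [← val_restrict]
  exact congrArg (fun r : ((res i).obj V).Sections P => r.val p)
    (LinearEquiv.apply_ofBijective_symm_apply (restrict i hG V P) s)

/-- Every compatibility of `extend`, and the uniqueness of the canonical isomorphism, is reduced by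
this criterion to an evaluation at the points `[p, 1]`. -/
theorem extend_unique {s : ((res i).obj V).Sections P} {t : V.Sections (P.induce i hG)}
    (h : ∀ {B : CommAlgCat.{u} k} {b : A ⟶ B} (p : P.pt b),
      t.val (P.toInduce i hG p) = s.val p) : t = extend i hG V P s :=
  restrict_injective i hG (ext fun p => (h p).trans (val_extend i hG s p).symm)

theorem pull_extend {A' : CommAlgCat.{u} k} {f : A ⟶ A'} {P' : Torsor H A'}
    (e : Torsor.IsoOver f P' P) (s : ((res i).obj V).Sections P) :
    pull (e.induce i hG) (extend i hG V P s) = extend i hG V P' (pull e s) :=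
  extend_unique i hG fun p => by
    rw [val_pull, val_pull, Torsor.IsoOver.induce_toInduce, val_extend]

theorem pushRep_extend {W : FinRep G} (φ : V ⟶ W) (s : ((res i).obj V).Sections P) :
    pushRep φ (extend i hG V P s) = extend i hG W P (pushRep ((res i).map φ) s) :=
  extend_unique i hG fun p => by
    rw [val_pushRep, val_extend]
    rfl

end FinRep.Sections

/-! ### The canonical isomorphism of bundles on `Loc^sph` and its uniqueness. -/

namespace CGroupDatum

variable {F : Type w} [Field F] [ValuativeRel F] [TopologicalSpace F]
  [IsNonarchimedeanLocalField F]
  {Ft : IntermediateField F (AlgebraicClosure F)} [FiniteDimensional F Ft] [IsGalois F Ft]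
  (D : CGroupDatum.{u} Ft) (c : TameChoice F)

/-- The canonical isomorphism for a single representation. -/
def canonicalApp (V : FinRep D.grp) : (D.sphBundle c).obj V ≅ (D.locBundle c).obj V :=
  PresheafOfModules.isoMk
    (fun x => LinearEquiv.toModuleIso (R := x.unop.ring)
      (FinRep.Sections.extend D.incl D.isSheaf V x.unop.torsor)) <| by
    intro x y α
    ext s
    exact (FinRep.Sections.pull_extend D.incl D.isSheaf (QuotStack.Hom.iso α.unop) s).symm

/-- The canonical isomorphism. -/
def canonicalIso : D.sphBundle c ≅ D.locBundle c :=
  NatIso.ofComponents (D.canonicalApp c) fun {V W} φ => by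
    ext x s
    exact (FinRep.Sections.pushRep_extend D.incl D.isSheaf (P := x.unop.torsor) φ s).symm

theorem isCanonical_canonicalIso : D.IsCanonical c (D.canonicalIso c) := fun V _ s {_ _} p =>
  FinRep.Sections.val_extend (V := V) D.incl D.isSheaf s p

/-- The formula `[p, v] ↦ [[p, 1], v]` fixes the image section at all points `[p, 1]`, and these
values determine it even when `P` has no global point. -/
theorem IsCanonical.eq_canonicalIso {θ : D.sphBundle c ≅ D.locBundle c}
    (hθ : D.IsCanonical c θ) : θ = D.canonicalIso c := by
  ext V x s
  exact FinRep.Sections.extend_unique (V := V) D.incl D.isSheaf (P := x.unop.torsor)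
    fun p => hθ V x.unop s p

end CGroupDatum

end InducedSections

/-! ### Sections of an associated bundle as descent data at a point over a cover. -/

section SectionsOverCover

variable {k : Type} [CommRing k] {G : CommAlgCat.{u} k ⥤ GrpCat.{u}} {A : CommAlgCat.{u} k}

namespace Torsor

theorem diff_map (P : Torsor G A) {B C : CommAlgCat.{u} k} {b : A ⟶ B} {c : A ⟶ C} (f : B ⟶ C)
    (hf : b ≫ f = c) (p q : P.pt b) :
    P.diff (P.map f hf p) (P.map f hf q) = G.map f (P.diff p q) := by
  apply P.act_injective (P.map f hf p)
  rw [P.act_diff, ← P.map_act, P.act_diff]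

theorem diff_act (P : Torsor G A) {B : CommAlgCat.{u} k} {b : A ⟶ B} (p q : P.pt b) (g : G.obj B) :
    P.diff p (P.act q g) = P.diff p q * g := by
  apply P.act_injective p
  rw [P.act_diff, P.act_mul, P.act_diff]

theorem diff_mul_diff (P : Torsor G A) {B : CommAlgCat.{u} k} {b : A ⟶ B} (p q r : P.pt b) :
    P.diff p q * P.diff q r = P.diff p r := by
  apply P.act_injective p
  rw [P.act_diff, P.act_mul, P.act_diff, P.act_diff]

theorem diff_self (P : Torsor G A) {B : CommAlgCat.{u} k} {b : A ⟶ B} (p : P.pt b) :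
    P.diff p p = 1 := by
  apply P.act_injective p
  rw [P.act_diff, P.act_one]

end Torsor

namespace FinRep.Sections

variable {V : FinRep G} {P : Torsor G A}

theorem val_eq_ρ_diff (s : V.Sections P) {B : CommAlgCat.{u} k} {b : A ⟶ B} (p q : P.pt b) :
    s.val q = V.ρ B (P.diff p q)⁻¹ (s.val p) := by
  rw [← s.val_act, P.act_diff]

/-- A section is determined by its value at a point over an fppf covering. -/
theorem val_injective {B : CommAlgCat.{u} k} {b : A ⟶ B} (hb : IsFppf b) (p : P.pt b) :
    Function.Injective fun s : V.Sections P => s.val p := by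
  intro s t hst
  refine ext_of_locally fun {C c} q => ?_
  -- Over `D` both `p` and `q` are available, and there `q` is a translate of `p` by an element of
  -- the group.
  obtain ⟨D, d, f, hd, hf⟩ := isFppf_pushout hb c
  refine ⟨D, f, hf, ?_⟩
  rw [s.val_eq_ρ_diff (P.map d hd p), t.val_eq_ρ_diff (P.map d hd p), s.val_map, t.val_map]
  exact congrArg (fun x => V.ρ D _ (bc V.V d x)) hst

/-- A value at a point `p` over an fppf covering extends to a section if it satisfies the descent
condition. -/
theorem exists_val_eq {B : CommAlgCat.{u} k} {b : A ⟶ B} (hb : IsFppf b) (p : P.pt b)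
    (m : B ⊗[k] V.V)
    (hm : ∀ {D : CommAlgCat.{u} k} {d : A ⟶ D} (u v : B ⟶ D) (hu : b ≫ u = d) (hv : b ≫ v = d),
      bc V.V v m = V.ρ D (P.diff (P.map u hu p) (P.map v hv p))⁻¹ (bc V.V u m)) :
    ∃ s : V.Sections P, s.val p = m := by
  -- Over an algebra `C` that receives a map `f` from `B`, the value at `q` must be the image of `m`
  -- translated by the difference of `f(p)` and `q`. Independence of `f` is the descent condition
  -- `hm` combined with the cocycle identity `diff_mul_diff`.
  obtain ⟨s, hs⟩ := exists_of_rel V P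
    (fun {C c} q x => ∃ (f : B ⟶ C) (hf : b ≫ f = c),
      x = V.ρ C (P.diff (P.map f hf p) q)⁻¹ (bc V.V f m))
    (by
      rintro C D c d g hg q _ ⟨f, hf, rfl⟩
      refine ⟨f ≫ g, by rw [← hg, ← hf, Category.assoc], ?_⟩
      rw [P.map_comp f g hf hg, P.diff_map, V.natural, map_inv, bc_comp])
    (by
      rintro C c q g _ ⟨f, hf, rfl⟩
      refine ⟨f, hf, ?_⟩
      rw [P.diff_act, mul_inv_rev, ρ_mul_apply])
    (by
      rintro C c q _ _ ⟨f, hf, rfl⟩ ⟨g, hg, rfl⟩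
      rw [hm f g hf hg, ← ρ_mul_apply, ← mul_inv_rev, P.diff_mul_diff])
    (by
      intro C c q
      obtain ⟨D, d, f, hd, hf⟩ := isFppf_pushout hb c
      exact ⟨D, f, _, hf, d, hd, rfl⟩)
  refine ⟨s, hs p m ⟨𝟙 B, Category.comp_id b, ?_⟩⟩
  rw [P.map_id, P.diff_self, inv_one, ρ_one_apply, bc_id]

/-- Description of sections by values at a point over an fppf covering; `E` plays the role of the
fibre product of the covering with itself. -/
theorem exists_val_eq_iff {B E : CommAlgCat.{u} k} {b : A ⟶ B} (hb : IsFppf b) (p : P.pt b)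
    {l r : B ⟶ E} (hlr : b ≫ r = b ≫ l)
    (huniv : ∀ {D : CommAlgCat.{u} k} (u v : B ⟶ D), b ≫ u = b ≫ v →
      ∃ t : E ⟶ D, l ≫ t = u ∧ r ≫ t = v) (m : B ⊗[k] V.V) :
    (∃ s : V.Sections P, s.val p = m) ↔
      bc V.V r m = V.ρ E (P.diff (P.map l rfl p) (P.map r hlr p))⁻¹ (bc V.V l m) := by
  constructor
  · rintro ⟨s, rfl⟩
    rw [← s.val_map r hlr, ← s.val_map l rfl]
    exact s.val_eq_ρ_diff _ _
  -- Every pair `u`, `v` that agrees on `A` factors through the universal pair `l`, `r`. The descent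
  -- condition for it is the image of the single equation over `E`.
  · refine fun hm => exists_val_eq hb p m fun {D d} u v hu hv => ?_
    obtain ⟨t, rfl, rfl⟩ := huniv u v (hu.trans hv.symm)
    rw [P.map_comp l t rfl (by rw [Category.assoc, hu]),
      P.map_comp r t hlr (by rw [Category.assoc, hu]), P.diff_map, bc_comp, bc_comp, hm, V.natural,
      map_inv]

end FinRep.Sections

theorem isFppf_id (A : CommAlgCat.{u} k) : IsFppf (𝟙 A) :=
  ⟨RingHom.FaithfullyFlat.of_bijective Function.bijective_id, RingHom.FinitePresentation.id A⟩

/-- The universal property of the tensor product, for morphisms of `k`-algebras. -/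
theorem exists_tensor_desc {A B C D : CommAlgCat.{u} k} [Algebra A B] [Algebra A C]
    [IsScalarTower k A B] [IsScalarTower k A C] (u : B ⟶ D) (v : C ⟶ D)
    (huv : ∀ a : A, u.hom (algebraMap A B a) = v.hom (algebraMap A C a)) :
    ∃ t : CommAlgCat.of k (B ⊗[A] C) ⟶ D,
      CommAlgCat.ofHom
        ((Algebra.TensorProduct.includeLeft : B →ₐ[A] B ⊗[A] C).restrictScalars k) ≫ t = u ∧
      CommAlgCat.ofHom
        ((Algebra.TensorProduct.includeRight : C →ₐ[A] B ⊗[A] C).restrictScalars k) ≫ t = v := by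
  -- `D` has no given `A`-algebra structure. With the one coming from `u`, the map `u` is `A`-linear
  -- by definition and `v` is `A`-linear by `huv`.
  let _ : Algebra A D := (u.hom.toRingHom.comp (algebraMap A B)).toAlgebra
  have : IsScalarTower k A D := .of_algebraMap_eq fun x => by
    change _ = u.hom (algebraMap A B (algebraMap k A x))
    rw [← IsScalarTower.algebraMap_apply, u.hom.commutes]
  let u' : B →ₐ[A] D := { u.hom.toRingHom with commutes' := fun a => rfl }
  let v' : C →ₐ[A] D := { v.hom.toRingHom with commutes' := fun a => (huv a).symm }
  refine ⟨CommAlgCat.ofHom ((Algebra.TensorProduct.lift u' v' fun _ _ => .all _ _).restrictScalars k),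
    ?_, ?_⟩
  · ext x
    change Algebra.TensorProduct.lift u' v' (fun _ _ => .all _ _) (x ⊗ₜ 1) = u' x
    simp
  · ext x
    change Algebra.TensorProduct.lift u' v' (fun _ _ => .all _ _) (1 ⊗ₜ x) = v' x
    simp

end SectionsOverCover

/-! ### Base change of sections, for torsors with a point and for flat ring maps. -/

section BaseChange

variable {k : Type} [CommRing k] {G : CommAlgCat.{u} k ⥤ GrpCat.{u}} {A : CommAlgCat.{u} k}

theorem Torsor.map_congr (P : Torsor G A) {B C : CommAlgCat.{u} k} {b : A ⟶ B} {c : A ⟶ C}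
    {f g : B ⟶ C} (h : f = g) (hf : b ≫ f = c) (hg : b ≫ g = c) (p : P.pt b) :
    P.map f hf p = P.map g hg p := by
  subst h
  rfl

namespace FinRep.Sections

variable (V : FinRep G) {P : Torsor G A}

/-- The pullback of sections along `e : P' ≅ f^* P` exhibits the sections over `P'` as the base
change along `f` of the sections over `P`. -/
def PullIsBaseChange {A' : CommAlgCat.{u} k} {f : A ⟶ A'} {P' : Torsor G A'}
    (e : Torsor.IsoOver f P' P) : Prop :=
  letI : Algebra A A' := f.hom.toRingHom.toAlgebra
  letI : Module A (V.Sections P') := Module.compHom _ f.hom.toRingHom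
  haveI : IsScalarTower A A' (V.Sections P') := ⟨fun _ b m => mul_smul _ b m⟩
  IsBaseChange A'
    ({ toFun := pull e
       map_add' := fun _ _ => rfl
       map_smul' := fun _ _ => rfl } : V.Sections P →ₗ[A] V.Sections P')

variable {V}

/-- The sections over a torsor with a global point. -/
def evalEquiv (p : P.pt (𝟙 A)) : V.Sections P ≃ₗ[A] A ⊗[k] V.V :=
  LinearEquiv.ofBijective
    { toFun := fun s => s.val p
      map_add' := fun _ _ => rfl
      map_smul' := fun _ _ => rfl }
    ⟨val_injective (isFppf_id A) p, fun m => exists_val_eq (isFppf_id A) p m fun u v hu hv => by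
      obtain rfl : u = v := by simpa using hu.trans hv.symm
      rw [P.diff_self, inv_one, ρ_one_apply]⟩

theorem val_equiv_symm {A' : CommAlgCat.{u} k} {f : A ⟶ A'} {P' : Torsor G A'}
    (e : Torsor.IsoOver f P' P) {B : CommAlgCat.{u} k} {b' : A' ⟶ B} {b : A ⟶ B}
    (hb : f ≫ b' = b) (s : V.Sections P) (p : P.pt b) :
    (pull e s).val ((e.equiv hb).symm p) = s.val p := by
  subst hb
  rw [val_pull, Equiv.apply_symm_apply]

theorem tensor_hom_ext {A B C D : CommAlgCat.{u} k} [Algebra A B] [Algebra A C]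
    [IsScalarTower k A B] [IsScalarTower k A C] {s t : CommAlgCat.of k (B ⊗[A] C) ⟶ D}
    (hl : CommAlgCat.ofHom
        ((Algebra.TensorProduct.includeLeft : B →ₐ[A] B ⊗[A] C).restrictScalars k) ≫ s =
      CommAlgCat.ofHom
        ((Algebra.TensorProduct.includeLeft : B →ₐ[A] B ⊗[A] C).restrictScalars k) ≫ t)
    (hr : CommAlgCat.ofHom
        ((Algebra.TensorProduct.includeRight : C →ₐ[A] B ⊗[A] C).restrictScalars k) ≫ s =
      CommAlgCat.ofHom
        ((Algebra.TensorProduct.includeRight : C →ₐ[A] B ⊗[A] C).restrictScalars k) ≫ t) :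
    s = t := by
  ext x
  refine TensorProduct.induction_on (motive := fun x : B ⊗[A] C => s.hom x = t.hom x) x ?_ ?_ ?_
  · exact (map_zero s.hom).trans (map_zero t.hom).symm
  · intro b c
    have h1 : b ⊗ₜ[A] c = (b ⊗ₜ 1) * (1 ⊗ₜ c) := by simp
    rw [h1]
    refine (map_mul s.hom _ _).trans (Eq.trans ?_ (map_mul t.hom _ _).symm)
    exact congrArg₂ (· * ·) (congrArg (fun m => m.hom b) hl) (congrArg (fun m => m.hom c) hr)
  · intro x y hx hy
    exact (map_add s.hom x y).trans ((congrArg₂ (· + ·) hx hy).trans (map_add t.hom x y).symm)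

/-- With `φ` the action of the inverse of the transition element on `E ⊗ V`, the kernel of this map
is the set of values that satisfy the descent condition. The point of the statement is linearity
over the base `R`, which holds because `l` and `r` are compatible with the maps from `R`. -/
theorem exists_descentMap {R : Type*} [CommRing R] {V : Type u} [AddCommGroup V] [Module k V]
    [Algebra k R] {B E : CommAlgCat.{u} k} [Algebra R B] [Algebra R E] [IsScalarTower k R B]
    [IsScalarTower k R E] (l r : B ⟶ E) (hl : ∀ a, l.hom (algebraMap R B a) = algebraMap R E a)
    (hr : ∀ a, r.hom (algebraMap R B a) = algebraMap R E a) (φ : Module.End E (E ⊗[k] V)) :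
    ∃ β : B ⊗[k] V →ₗ[R] E ⊗[k] V, ∀ m, β m = bc V r m - φ (bc V l m) := by
  refine ⟨{ toFun := fun m => bc V r m - φ (bc V l m), map_add' := fun x y => ?_,
            map_smul' := fun a x => ?_ }, fun _ => rfl⟩
  · simp only [map_add]
    abel
  · rw [← algebraMap_smul B a x, bc_smul, bc_smul, hl, hr, map_smul]
    exact (smul_sub (algebraMap R E a) _ _).symm.trans (algebraMap_smul E a _)

/-- If the ring map `g` exhibits its target as a base change of its source along `A ⟶ A'`, so does
the map `bc V g`. -/
theorem isBaseChange_bc (V : Type u) [AddCommGroup V] [Module k V] {A A' : CommAlgCat.{u} k}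
    [Algebra A A'] [IsScalarTower k A A'] {B B' : CommAlgCat.{u} k}
    [Algebra A B] [IsScalarTower k A B] [Algebra A B'] [Algebra A' B'] [IsScalarTower k A' B']
    [IsScalarTower A A' B'] [IsScalarTower k A B']
    (g : B ⟶ B') (j : B →ₗ[A] B') (hj : IsBaseChange A' j) (hgj : ∀ x, g.hom x = j x) :
    ∃ l : B ⊗[k] V →ₗ[A] B' ⊗[k] V, (∀ x, l x = bc V g x) ∧ IsBaseChange A' l := by
  refine ⟨AlgebraTensorModule.map j LinearMap.id, fun x => ?_,
    isBaseChange_tensorProduct_map A' hj⟩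
  induction x with
  | zero => simp
  | add x y hx hy => simp only [map_add, hx, hy]
  | tmul b v => simp [bc, hgj]

/-- Evaluation at `p`, and at its transport `p'` to `P'`, turns the pullback of sections into the
map `A ⊗ V ⟶ A' ⊗ V`. No flatness of `f` is needed. -/
theorem pullIsBaseChange_of_point {A' : CommAlgCat.{u} k} {f : A ⟶ A'} {P' : Torsor G A'}
    (e : Torsor.IsoOver f P' P) (p : P.pt (𝟙 A)) : PullIsBaseChange V e := by
  let _ : Algebra A A' := f.hom.toRingHom.toAlgebra
  let _ : Module A (V.Sections P') := Module.compHom _ f.hom.toRingHom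
  have : IsScalarTower A A' (V.Sections P') := ⟨fun _ b m => mul_smul _ b m⟩
  have : IsScalarTower k A A' := .of_algebraMap_eq fun x => (f.hom.commutes x).symm
  have hf : f ≫ 𝟙 A' = 𝟙 A ≫ f := by simp
  let p' : P'.pt (𝟙 A') := (e.equiv hf).symm (P.map f rfl p)
  obtain ⟨l, hl, hbc⟩ := isBaseChange_bc V.V f (Algebra.linearMap A A')
    (IsBaseChange.linearMap A A') fun _ => rfl
  refine (IsBaseChange.iff_of_equiv_comm (evalEquiv p) (evalEquiv p') (f' := l) ?_).mpr hbc
  ext s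
  change l (s.val p) = (pull e s).val p'
  rw [hl, ← s.val_map f rfl]
  exact (val_equiv_symm e hf s _).symm

/-- Flat base change of sections, for a torsor trivialized by a covering `b : A ⟶ B` with
self-intersection `E`; `b' : A' ⟶ B'` and `E'` are the base changes to `A'`. -/
theorem isBaseChange_pull_of_cover {A' B E B' E' : CommAlgCat.{u} k} [Algebra A A'] [Algebra A B]
    [Algebra A E] [Algebra A B'] [Algebra A' B'] [Algebra A E'] [Algebra A' E']
    [IsScalarTower k A A'] [IsScalarTower k A B] [IsScalarTower k A E] [IsScalarTower k A B']
    [IsScalarTower k A' B'] [IsScalarTower A A' B'] [IsScalarTower k A E'] [IsScalarTower k A' E']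
    [IsScalarTower A A' E'] [Module.Flat A A']
    {f : A ⟶ A'} {P' : Torsor G A'} (e : Torsor.IsoOver f P' P) [Module A (V.Sections P')]
    [IsScalarTower A A' (V.Sections P')] {b : A ⟶ B} (hb : IsFppf b) (p : P.pt b)
    {b' : A' ⟶ B'} (hb' : IsFppf b') (hbA : ∀ a, b.hom a = algebraMap A B a)
    (hbA' : ∀ a, b'.hom a = algebraMap A' B' a)
    {l r : B ⟶ E} {l' r' : B' ⟶ E'} {iB : B ⟶ B'} {iE : E ⟶ E'} (hlr : b ≫ r = b ≫ l)
    (hlr' : b' ≫ r' = b' ≫ l') (hiB : f ≫ b' = b ≫ iB) (hl' : iB ≫ l' = l ≫ iE)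
    (hr' : iB ≫ r' = r ≫ iE)
    (huniv : ∀ {D : CommAlgCat.{u} k} (u v : B ⟶ D), b ≫ u = b ≫ v →
      ∃ t : E ⟶ D, l ≫ t = u ∧ r ≫ t = v)
    (huniv' : ∀ {D : CommAlgCat.{u} k} (u v : B' ⟶ D), b' ≫ u = b' ≫ v →
      ∃ t : E' ⟶ D, l' ≫ t = u ∧ r' ≫ t = v)
    (hlA : ∀ a, l.hom (algebraMap A B a) = algebraMap A E a)
    (hrA : ∀ a, r.hom (algebraMap A B a) = algebraMap A E a)
    (hlA' : ∀ a, l'.hom (algebraMap A' B' a) = algebraMap A' E' a)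
    (hrA' : ∀ a, r'.hom (algebraMap A' B' a) = algebraMap A' E' a)
    {jB : B →ₗ[A] B'} (hjB : IsBaseChange A' jB) (hiBj : ∀ x, iB.hom x = jB x)
    {jE : E →ₗ[A] E'} (hjE : IsBaseChange A' jE) (hiEj : ∀ x, iE.hom x = jE x)
    {j : V.Sections P →ₗ[A] V.Sections P'} (hj : ∀ s, j s = pull e s) : IsBaseChange A' j := by
  let p' : P'.pt b' := (e.equiv hiB).symm (P.map iB rfl p)
  -- The transition element of `p'` over `E'` is the image of that of `p` over `E`, since `p'`
  -- corresponds to the image of `p` and isomorphisms of torsors preserve differences. The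
  -- comparison takes place in `P` over the common arrow `f ≫ b' ≫ x'`.
  have hg : (P'.diff (P'.map l' rfl p') (P'.map r' hlr' p'))⁻¹ =
      G.map iE (P.diff (P.map l rfl p) (P.map r hlr p))⁻¹ := by
    rw [map_inv, inv_inj]
    have h1 : ∀ {x y : B ⟶ E} {x' y' : B' ⟶ E'} (hxy : b ≫ y = b ≫ x) (hxy' : b' ≫ y' = b' ≫ x')
        (hx : iB ≫ x' = x ≫ iE) (hy : iB ≫ y' = y ≫ iE),
        P'.diff (P'.map x' rfl p') (P'.map y' hxy' p') =
          G.map iE (P.diff (P.map x rfl p) (P.map y hxy p)) := by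
      intro x y x' y' hxy hxy' hx hy
      have h2 : (b ≫ x) ≫ iE = f ≫ b' ≫ x' := by
        rw [← Category.assoc, hiB, Category.assoc, Category.assoc, hx]
      have h3 : (b ≫ iB) ≫ x' = f ≫ b' ≫ x' := by rw [← hiB, Category.assoc]
      have h4 : (b ≫ iB) ≫ y' = f ≫ b' ≫ x' := by rw [← hiB, Category.assoc, hxy']
      rw [← P.diff_map iE h2, ← e.diff_equiv (b := f ≫ b' ≫ x') rfl,
        e.natural hiB rfl x' rfl h3, e.natural hiB rfl y' hxy' h4, Equiv.apply_symm_apply]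
      congr 1
      · rw [← P.map_comp iB x' rfl h3 (by rw [← h3, Category.assoc]),
          ← P.map_comp x iE rfl h2 (by rw [← h2, Category.assoc])]
        exact P.map_congr hx _ _ p
      · rw [← P.map_comp iB y' rfl h4 (by rw [← h4, Category.assoc]),
          ← P.map_comp y iE hxy h2 (by rw [← h2, ← hxy, Category.assoc])]
        exact P.map_congr hy _ _ p
    exact h1 hlr hlr' hl' hr'
  obtain ⟨gB, hgB, hgB'⟩ := isBaseChange_bc (A := A) (A' := A') V.V iB jB hjB hiBj
  obtain ⟨gE, hgE, hgE'⟩ := isBaseChange_bc (A := A) (A' := A') V.V iE jE hjE hiEj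
  obtain ⟨β, hβ⟩ := exists_descentMap (R := A) (V := V.V) l r hlA hrA
    (V.ρ E (P.diff (P.map l rfl p) (P.map r hlr p))⁻¹)
  obtain ⟨β', hβ'⟩ := exists_descentMap (R := A') (V := V.V) l' r' hlA' hrA'
    (V.ρ E' (P'.diff (P'.map l' rfl p') (P'.map r' hlr' p'))⁻¹)
  -- Evaluation at `p` and at `p'` presents the two modules of sections as the kernels of `β` and
  -- `β'`. The middle and right terms are base changes of each other by `isBaseChange_bc`, so
  -- flatness of `A'` over `A` gives the claim for the kernels.
  refine isBaseChange_of_exact (S := A')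
    (α := ({ toFun := fun s => s.val p
             map_add' := fun _ _ => rfl
             map_smul' := fun a s => by
               change b.hom a • s.val p = a • s.val p
               rw [hbA, algebraMap_smul] } :
               V.Sections P →ₗ[A] B ⊗[k] V.V))
    (α' := ({ toFun := fun s => s.val p'
              map_add' := fun _ _ => rfl
              map_smul' := fun a s => by
                change b'.hom a • s.val p' = a • s.val p'
                rw [hbA', algebraMap_smul] } :
                V.Sections P' →ₗ[A'] B' ⊗[k] V.V))
    (β := β) (β' := β') (g := gB) (h := gE) (val_injective hb p) ?_ (val_injective hb' p') ?_
    hgB' hgE' ?_ ?_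
  · intro m
    rw [hβ, sub_eq_zero]
    exact (exists_val_eq_iff hb p hlr huniv m).symm
  · intro m
    rw [hβ', sub_eq_zero]
    exact (exists_val_eq_iff hb' p' hlr' huniv' m).symm
  · intro s
    rw [hgB, hj]
    refine (val_equiv_symm e hiB s _).trans (s.val_map iB rfl p)
  · intro m
    rw [hgB, hgE, hβ, hβ', hg, map_sub, V.natural, ← bc_comp, ← bc_comp, ← bc_comp, ← bc_comp, hl',
      hr']

/-- The content is in `isBaseChange_pull_of_cover`. It is applied to a cover `B` over which `P` has
a point, to `B ⊗[A] B`, and to the base changes of both to `A'`. -/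
theorem pullIsBaseChange_of_flat {A' : CommAlgCat.{u} k} {f : A ⟶ A'} (hf : f.hom.toRingHom.Flat)
    {P' : Torsor G A'} (e : Torsor.IsoOver f P' P) : PullIsBaseChange V e := by
  obtain ⟨B, b, hb, ⟨p⟩⟩ : ∃ (B : CommAlgCat.{u} k) (b : A ⟶ B), IsFppf b ∧ Nonempty (P.pt b) := by
    obtain ⟨B, b, hb, hp⟩ := P.locally_nonempty (𝟙 A)
    exact ⟨B, b, hb, by rwa [Category.id_comp] at hp⟩
  let _ : Algebra A A' := f.hom.toRingHom.toAlgebra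
  let _ : Module A (V.Sections P') := Module.compHom _ f.hom.toRingHom
  have : IsScalarTower A A' (V.Sections P') := ⟨fun _ b m => mul_smul _ b m⟩
  have : IsScalarTower k A A' := .of_algebraMap_eq fun x => (f.hom.commutes x).symm
  let _ : Algebra A B := b.hom.toRingHom.toAlgebra
  have : IsScalarTower k A B := .of_algebraMap_eq fun x => (b.hom.commutes x).symm
  have : Module.Flat A A' := hf
  have : Module.FaithfullyFlat A B := hb.1
  have : Algebra.FinitePresentation A B := hb.2
  let E : CommAlgCat.{u} k := .of k (B ⊗[A] B)
  let B' : CommAlgCat.{u} k := .of k (A' ⊗[A] B)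
  -- This model replaces `B' ⊗[A'] B'`. It is a base change of `E` by construction, at the price of
  -- a separate proof of its universal property as the self-intersection of `B'`.
  let E' : CommAlgCat.{u} k := .of k (A' ⊗[A] (B ⊗[A] B))
  let l : B ⟶ E := CommAlgCat.ofHom
    ((Algebra.TensorProduct.includeLeft : B →ₐ[A] B ⊗[A] B).restrictScalars k)
  let r : B ⟶ E := CommAlgCat.ofHom
    ((Algebra.TensorProduct.includeRight : B →ₐ[A] B ⊗[A] B).restrictScalars k)
  let b' : A' ⟶ B' := CommAlgCat.ofHom
    ((Algebra.TensorProduct.includeLeft : A' →ₐ[A] A' ⊗[A] B).restrictScalars k)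
  let iB : B ⟶ B' := CommAlgCat.ofHom
    ((Algebra.TensorProduct.includeRight : B →ₐ[A] A' ⊗[A] B).restrictScalars k)
  let iE : E ⟶ E' := CommAlgCat.ofHom
    ((Algebra.TensorProduct.includeRight : B ⊗[A] B →ₐ[A] A' ⊗[A] (B ⊗[A] B)).restrictScalars k)
  let l' : B' ⟶ E' := CommAlgCat.ofHom ((Algebra.TensorProduct.map (.id A A')
    (Algebra.TensorProduct.includeLeft : B →ₐ[A] B ⊗[A] B)).restrictScalars k)
  let r' : B' ⟶ E' := CommAlgCat.ofHom ((Algebra.TensorProduct.map (.id A A')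
    (Algebra.TensorProduct.includeRight : B →ₐ[A] B ⊗[A] B)).restrictScalars k)
  have hlr : b ≫ r = b ≫ l := by
    ext a
    exact ((Algebra.TensorProduct.includeRight : B →ₐ[A] B ⊗[A] B).commutes a).trans
      ((Algebra.TensorProduct.includeLeft : B →ₐ[A] B ⊗[A] B).commutes a).symm
  have hb' : IsFppf b' := by
    constructor
    · exact (RingHom.faithfullyFlat_algebraMap_iff (R := A') (S := A' ⊗[A] B)).mpr inferInstance
    · exact (RingHom.finitePresentation_algebraMap (A := A') (B := A' ⊗[A] B)).mpr inferInstance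
  have hiB : f ≫ b' = b ≫ iB := by
    ext a
    exact ((Algebra.TensorProduct.includeLeft : A' →ₐ[A] A' ⊗[A] B).commutes a).trans
      ((Algebra.TensorProduct.includeRight : B →ₐ[A] A' ⊗[A] B).commutes a).symm
  have hl' : iB ≫ l' = l ≫ iE := by
    ext x
    change Algebra.TensorProduct.map (.id A A') _ (1 ⊗ₜ x) = _
    rw [Algebra.TensorProduct.map_tmul, map_one]
    rfl
  have hr' : iB ≫ r' = r ≫ iE := by
    ext x
    change Algebra.TensorProduct.map (.id A A') _ (1 ⊗ₜ x) = _
    rw [Algebra.TensorProduct.map_tmul, map_one]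
    rfl
  have hlr' : b' ≫ r' = b' ≫ l' := by
    ext x
    change Algebra.TensorProduct.map (.id A A') _ (x ⊗ₜ 1) =
      Algebra.TensorProduct.map (.id A A') _ (x ⊗ₜ 1)
    rw [Algebra.TensorProduct.map_tmul, Algebra.TensorProduct.map_tmul, map_one, map_one]
  have huniv : ∀ {D : CommAlgCat.{u} k} (u v : B ⟶ D), b ≫ u = b ≫ v →
      ∃ t : E ⟶ D, l ≫ t = u ∧ r ≫ t = v := fun u v huv =>
    exists_tensor_desc u v fun a => congrArg (fun m => m.hom a) huv
  have huniv' : ∀ {D : CommAlgCat.{u} k} (u v : B' ⟶ D), b' ≫ u = b' ≫ v →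
      ∃ t : E' ⟶ D, l' ≫ t = u ∧ r' ≫ t = v := by
    intro D u v huv
    have h1 : b ≫ iB ≫ u = b ≫ iB ≫ v := by
      rw [← Category.assoc, ← hiB, Category.assoc, huv, ← Category.assoc, hiB, Category.assoc]
    -- The restrictions of `u` and `v` to `B` define a map from `B ⊗[A] B`. Together with the common
    -- restriction of `u` and `v` to `A'`, it defines the map from `E'`.
    obtain ⟨t, ht, ht'⟩ := huniv (iB ≫ u) (iB ≫ v) h1
    obtain ⟨t', ht1, ht2⟩ := exists_tensor_desc (A := A) (B := A') (C := E) (b' ≫ u) t (by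
      intro a
      have h2 : f ≫ b' ≫ u = b ≫ l ≫ t := by
        rw [ht, ← Category.assoc, hiB, Category.assoc]
      exact congrArg (fun m => m.hom a) h2)
    refine ⟨t', ?_, ?_⟩
    · refine tensor_hom_ext ?_ ?_
      · rw [← ht1, ← Category.assoc]
        congr 1
      · change iB ≫ l' ≫ t' = iB ≫ u
        rw [← Category.assoc, hl', Category.assoc, ← ht]
        exact congrArg (l ≫ ·) ht2
    · refine tensor_hom_ext ?_ ?_
      · change b' ≫ r' ≫ t' = b' ≫ v
        rw [← huv, ← ht1, ← Category.assoc, hlr']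
        congr 1
      · change iB ≫ r' ≫ t' = iB ≫ v
        rw [← Category.assoc, hr', Category.assoc, ← ht']
        exact congrArg (r ≫ ·) ht2
  exact isBaseChange_pull_of_cover (E := E) (E' := E') e hb p hb' (fun _ => rfl) (fun _ => rfl)
    hlr hlr' hiB hl' hr' huniv huniv'
    (Algebra.TensorProduct.includeLeft : B →ₐ[A] B ⊗[A] B).commutes
    (Algebra.TensorProduct.includeRight : B →ₐ[A] B ⊗[A] B).commutes
    (fun a => by
      change Algebra.TensorProduct.map (.id A A') _ (a ⊗ₜ 1) = a ⊗ₜ 1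
      rw [Algebra.TensorProduct.map_tmul, map_one]
      rfl)
    (fun a => by
      change Algebra.TensorProduct.map (.id A A') _ (a ⊗ₜ 1) = a ⊗ₜ 1
      rw [Algebra.TensorProduct.map_tmul, map_one]
      rfl)
    (TensorProduct.isBaseChange A B A') (fun _ => rfl)
    (TensorProduct.isBaseChange A (B ⊗[A] B) A') (fun _ => rfl) (fun _ => rfl)

end FinRep.Sections
end BaseChange

/-! ### Local freeness and arbitrary base change of sections. -/

section VectorBundle

variable {k : Type} [CommRing k] {G : CommAlgCat.{u} k ⥤ GrpCat.{u}} {A : CommAlgCat.{u} k}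

namespace Torsor

/-- The base change of a torsor along `f : A ⟶ A'`. -/
def baseChange (P : Torsor G A) {A' : CommAlgCat.{u} k} (f : A ⟶ A') : Torsor G A' where
  pt b := P.pt (f ≫ b)
  map g hg := P.map g (by rw [Category.assoc, hg])
  map_id h p := P.map_id _ p
  map_comp g g' hg hg' h p := P.map_comp g g' _ _ _ p
  act := P.act
  act_one := P.act_one
  act_mul := P.act_mul
  map_act g hg p x := P.map_act g _ p x
  transitive := P.transitive
  locally_nonempty b := by
    obtain ⟨C, g, hg, ⟨p⟩⟩ := P.locally_nonempty (f ≫ b)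
    exact ⟨C, g, hg, ⟨P.map (𝟙 C) (by simp) p⟩⟩
  glue {B C b c} g hg hgf p hp := by
    refine P.glue g _ hgf p fun {D d} u v hu hv huv => ?_
    -- The gluing condition for `P` concerns arrows from `A`, but each arrow that occurs factors
    -- through `A'`. The hypothesis about arrows from `A'` therefore covers all cases.
    have h : c ≫ v = c ≫ u := by rw [← hg, Category.assoc, Category.assoc, huv]
    obtain rfl : f ≫ c ≫ u = d := by rw [← hu, Category.assoc]
    exact hp u v rfl h huv

/-- The identification of `P.baseChange f` with the base change of `P`. -/
def baseChangeIso (P : Torsor G A) {A' : CommAlgCat.{u} k} (f : A ⟶ A') :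
    IsoOver f (P.baseChange f) P where
  equiv {B b' b} hb :=
    { toFun := P.map (𝟙 B) (by rw [← hb, Category.comp_id])
      invFun := P.map (𝟙 B) (by rw [← hb, Category.comp_id])
      left_inv := fun p => by
        subst hb
        exact (P.map_id _ _).trans (P.map_id _ _)
      right_inv := fun p => by
        subst hb
        exact (P.map_id _ _).trans (P.map_id _ _) }
  natural {B C b' b c' c} hb hc g hg' hg p := by
    subst hb hc
    exact (P.map_id _ _).trans (congrArg (P.map g hg) (P.map_id _ _).symm)
  equivariant {B b' b} hb p g := by
    subst hb
    exact (P.map_id _ _).trans (congrArg (fun q => P.act q g) (P.map_id _ _).symm)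

/-- Base change of an isomorphism of torsors. -/
def IsoOver.baseChange {A' B D : CommAlgCat.{u} k} {f : A ⟶ A'} {P' : Torsor G A'}
    {P : Torsor G A} (e : IsoOver f P' P) {g : A' ⟶ D} {b : A ⟶ B} {h : B ⟶ D}
    (comm : f ≫ g = b ≫ h) : IsoOver h (P'.baseChange g) (P.baseChange b) where
  equiv {C c' c} hc := e.equiv (by rw [← hc, ← Category.assoc, comm, Category.assoc])
  natural hb hc x hx' hx p := e.natural _ _ x _ _ p
  equivariant hb p x := e.equivariant _ p x

end Torsor

namespace FinRep.Sections

variable {V : FinRep G} {P : Torsor G A}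

/-- For a commutative square of rings, pulling sections back along its two sides gives the same
result. This allows base change along one side to be deduced from the other. -/
theorem pull_baseChange {A' B D : CommAlgCat.{u} k} {f : A ⟶ A'} {P' : Torsor G A'}
    (e : Torsor.IsoOver f P' P) {g : A' ⟶ D} {b : A ⟶ B} {h : B ⟶ D} (comm : f ≫ g = b ≫ h)
    (s : V.Sections P) :
    pull (P'.baseChangeIso g) (pull e s) = pull (e.baseChange comm) (pull (P.baseChangeIso b) s) := by
  refine ext fun {C c} p => ?_
  have h1 : (pull e s).val (P'.map (𝟙 C) (Category.comp_id _) p) = (pull e s).val p :=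
    val_congr (P := P') _ _ _
  refine h1.trans (Eq.trans ?_ (val_congr (P := P) s _ _).symm)
  have h2 : ∀ {d : A ⟶ C} (hd : f ≫ g ≫ c = d),
      (pull e s).val p = s.val (e.equiv (b' := g ≫ c) hd p) := by
    intro d hd
    subst hd
    rfl
  exact h2 _

theorem finite_projective_of_point (p : P.pt (𝟙 A)) :
    Module.Finite A (V.Sections P) ∧ Module.Projective A (V.Sections P) :=
  ⟨Module.Finite.equiv (evalEquiv (V := V) p).symm,
    Module.Projective.of_equiv (evalEquiv (V := V) p).symm⟩

variable (V P)

/-- Over a cover `B` with a point the sections are `B ⊗ V`. By flat base change they are also the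
base change to `B` of the sections over `A`, so faithfully flat descent applies. -/
theorem finite_projective :
    Module.Finite A (V.Sections P) ∧ Module.Projective A (V.Sections P) := by
  obtain ⟨B, b, hb, ⟨p⟩⟩ := P.locally_nonempty (𝟙 A)
  rw [Category.id_comp] at p
  have p' : (P.baseChange b).pt (𝟙 B) := P.map (𝟙 B) rfl p
  let _ : Algebra A B := b.hom.toRingHom.toAlgebra
  let _ : Module A (V.Sections (P.baseChange b)) := Module.compHom _ b.hom.toRingHom
  have : IsScalarTower A B (V.Sections (P.baseChange b)) := ⟨fun _ b m => mul_smul _ b m⟩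
  have : Module.FaithfullyFlat A B := hb.1
  obtain ⟨h1, h2⟩ := finite_projective_of_point (V := V) p'
  exact finite_projective_of_isBaseChange (S := B)
    (pullIsBaseChange_of_flat (V := V) hb.1.flat (P.baseChangeIso b))

variable {P}

/-- The formation of sections commutes with arbitrary base change. -/
theorem pullIsBaseChange {A' : CommAlgCat.{u} k} {f : A ⟶ A'} {P' : Torsor G A'}
    (e : Torsor.IsoOver f P' P) : PullIsBaseChange V e := by
  obtain ⟨B, b, hb, ⟨p⟩⟩ := P.locally_nonempty (𝟙 A)
  rw [Category.id_comp] at p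
  have p' : (P.baseChange b).pt (𝟙 B) := P.map (𝟙 B) rfl p
  -- Base change along `A ⟶ B` holds by flatness, and along `B ⟶ D` because `P` has a point over
  -- `B`. It therefore holds along the composite `A ⟶ D`, which is also `A ⟶ A' ⟶ D`. Since `A' ⟶ D`
  -- is faithfully flat, and base change holds along it, it can be cancelled, which leaves `A ⟶ A'`.
  obtain ⟨D, h, g, comm, hg⟩ := isFppf_pushout hb f
  let Q := P'.baseChange g
  let _ : Algebra A A' := f.hom.toRingHom.toAlgebra
  let _ : Algebra A B := b.hom.toRingHom.toAlgebra
  let _ : Algebra B D := h.hom.toRingHom.toAlgebra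
  let _ : Algebra A' D := g.hom.toRingHom.toAlgebra
  let _ : Algebra A D := (f ≫ g).hom.toRingHom.toAlgebra
  have hAB : IsScalarTower A B D := .of_algebraMap_eq fun x =>
    congrArg (fun m => m.hom x) comm.symm
  have hAA' : IsScalarTower A A' D := .of_algebraMap_eq fun _ => rfl
  let _ : Module A (V.Sections P') := Module.compHom _ f.hom.toRingHom
  have : IsScalarTower A A' (V.Sections P') := ⟨fun _ b m => mul_smul _ b m⟩
  let _ : Module A (V.Sections (P.baseChange b)) := Module.compHom _ b.hom.toRingHom
  have : IsScalarTower A B (V.Sections (P.baseChange b)) := ⟨fun _ b m => mul_smul _ b m⟩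
  let _ : Module A' (V.Sections Q) := Module.compHom _ g.hom.toRingHom
  have : IsScalarTower A' D (V.Sections Q) := ⟨fun _ b m => mul_smul _ b m⟩
  let _ : Module B (V.Sections Q) := Module.compHom _ h.hom.toRingHom
  have : IsScalarTower B D (V.Sections Q) := ⟨fun _ b m => mul_smul _ b m⟩
  let _ : Module A (V.Sections Q) := Module.compHom _ (f ≫ g).hom.toRingHom
  have : IsScalarTower A D (V.Sections Q) := ⟨fun _ b m => mul_smul _ b m⟩
  have : IsScalarTower A A' (V.Sections Q) := .of_algebraMap_smul fun _ _ => rfl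
  have : IsScalarTower A B (V.Sections Q) := .of_algebraMap_smul fun a s => by
    rw [← algebraMap_smul D, ← IsScalarTower.algebraMap_apply, algebraMap_smul]
  have : Module.FaithfullyFlat A' D := hg.1
  have h1 := pullIsBaseChange_of_flat (V := V) hb.1.flat (P.baseChangeIso b)
  have h2 := pullIsBaseChange_of_point (V := V) (e.baseChange comm.symm) p'
  have h3 := pullIsBaseChange_of_flat (V := V) hg.1.flat (P'.baseChangeIso g)
  refine isBaseChange_of_comp_faithfullyFlat (T := D) h3 ?_
  convert IsBaseChange.comp h1 h2 using 1
  exact LinearMap.ext fun s => pull_baseChange e comm.symm s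

end FinRep.Sections

theorem isVectorBundle_tilde (X : GSpace.{u, w} G) (V : FinRep G) :
    IsVectorBundle ((FinRep.tilde X).obj V) :=
  ⟨fun x => (FinRep.Sections.finite_projective V x.unop.torsor).1,
    fun x => (FinRep.Sections.finite_projective V x.unop.torsor).2,
    fun α => FinRep.Sections.pullIsBaseChange V (QuotStack.Hom.iso α.unop)⟩

end VectorBundle

end LanglandsParameters

end

theorem mainTheorem6 {F : Type w} [Field F] [ValuativeRel F] [TopologicalSpace F]
    [IsNonarchimedeanLocalField F]
    (Ft : IntermediateField F (AlgebraicClosure F)) [FiniteDimensional F Ft] [IsGalois F Ft]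
    (D : LanglandsParameters.CGroupDatum.{u} Ft) (c : LanglandsParameters.TameChoice F) :
    (∀ V : LanglandsParameters.FinRep D.grp,
      LanglandsParameters.IsVectorBundle
        ((LanglandsParameters.FinRep.tilde (D.locSpace c)).obj V) ∧
      LanglandsParameters.IsVectorBundle ((D.sphBundle c).obj V)) ∧
    ∃! θ : D.sphBundle c ≅ D.locBundle c, D.IsCanonical c θ := by
  -- The bundle on `Loc^sph` is by definition attached to the restricted representation, so the same
  -- general result covers both bundles, once for `Ĝ` and once for `Ĝ^I`.
  exact ⟨fun V => ⟨LanglandsParameters.isVectorBundle_tilde _ V,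
    LanglandsParameters.isVectorBundle_tilde _ ((LanglandsParameters.FinRep.res D.incl).obj V)⟩,
    D.canonicalIso c, D.isCanonical_canonicalIso c, fun _ hθ => hθ.eq_canonicalIso⟩
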